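/- **Setting.** Let $d_x,d,h,n,B\ge 0$ and $n_v,b\ge 1$ be integers. Let $f:\mathbb{R}^{d_x}\times\mathbb{R}^d\to\mathbb{R}$, $(x,w)\mapsto f(x;w)$, be differentiable in $w$; let $l:\mathbb{R}\times\mathbb{R}\to\mathbb{R}$, $(y,y')\mapsto l(y,y')$ ($y$ the true output, $y'$ the prediction) be differentiable in $y'$; and let $r:\mathbb{R}^d\times\mathbb{R}^h\to\mathbb{R}^d$, $(w,\theta)\mapsto r(w;\theta)$. A task is $P=(X,y,X_v,y_v)$ with $n$ training examples $(X^{(i)},y^{(i)})$ and $n_v$ validation examples $(X_v^{(i)},y_v^{(i)})$ in $\mathbb{R}^{d_x}\times\mathbb{R}$. A hyperparameter is $\phi=(\theta,\sqrt\eta)$ with $\theta\in\mathbb{R}^h$ and learning rate $\eta>0$. Given noise $\xi=(\xi_{(0)},\dots,\xi_{(B+b-1)})\in(\mathbb{R}^d)^{B+b}$, Langevin gradient descent (LGD) sets $w_{(0)}=0$ and, for $0\le k<B+b$, $$w_{(k+1)}=w_{(k)}-\eta\Big(\sum_{i=1}^n \partial_{y'}l\big(y^{(i)},f(X^{(i)};w_{(k)})\big)\,\nabla_w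 f(X^{(i)};w_{(k)})+r(w_{(k)};\theta)\Big)+\sqrt{2\eta}\,\xi_{(k)},$$ and predicts $\hat f_v(x_v)=\frac1b\sum_{k=B+1}^{B+b}f(x_v;w_{(k)})$. Its validation loss is $l_v(\phi,\xi,P)=\frac1{n_v}\sum_{i=1}^{n_v} l\big(y_v^{(i)},\hat f_v(X_v^{(i)})\big)$. Let $\mathcal D$ be a Borel probability distribution on tasks with support $\mathcal P$, and $\mathcal D_E$ a Borel probability distribution on the noise. Put $l_v(\phi)=\mathbb{E}_{P\sim\mathcal D,\ \xi\sim\mathcal D_E}[l_v(\phi,\xi,P)]$ (with $P,\xi$ independent), and let $\mathcal L_v=\{l_v(\phi,\cdot,\cdot):(\mathbb{R}^d)^{B+b}\times\mathcal P\to\mathbb{R}\}_\phi$, where $\phi$ ranges over all hyperparameters. $\mathrm{Pdim}(\mathcal L_v)\in\mathbb{N}\cup\{\infty\}$ is its pseudo-dimension: the largest size of a finite set $Z$ of points for which there are thresholds $t_z$ such that for every $U\subseteq Z$ some $g\in\mathcal L_v$ satisfies $g(z)\ge t_z\iff z\in U$ for all $z\in Z$. For a sample of $T$ tasks $P^t\sim\mathcal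 D$ and noises $\xi^t\sim\mathcal D_E$ (all independent), let $\phi_{ERM}$ be a measurable function of the sample that almost surely minimizes $\phi\mapsto\frac1T\sum_{t=1}^T l_v(\phi,\xi^t,P^t)$ over all hyperparameters; and let $\phi^*$ be a minimizer of $l_v(\phi)$ over all hyperparameters. A GJ algorithm takes real inputs and performs arithmetic operations $+,-,\times,\div$ on inputs, real constants and previously computed values (never dividing by zero), and conditional statements "if $\nu\ge0$ … else …". Its degree is the maximal degree (maximum of the numerator and denominator degrees, in lowest terms) of a rational function of the inputs that it computes; its predicate complexity is the number of distinct rational functions in its conditional statements. **Theorem.** There is a universal constant $K>0$ such that the following holds for all $\Delta,\Lambda\in\mathbb{N}$ (fixed independently of the dimensions), in every setting as above. Assume that $l$, $f$ and every entry of $r$ are computed by GJ algorithms of degree at most $\Delta$ and predicate complexity at most $\Lambda$, and that $|l(y_v^{(i)},\hat f_v(X_v^{(i)}))|\le C$ for all $(X,y,X_v,y_v)\in\mathcal P$, all $i\le n_v$, all $\phi$ and all $\xi$. Then for all $\epsilon>0$, $\delta\in(0,1)$ and every integer $$T\ \ge\ K\,\frac{C^2}{\epsilon^2}\big(\mathrm{Pdim}(\mathcal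 L_v)+\log(1/\delta)\big),$$ with probability at least $1-\delta$ over the $T$ tasks and noises, $$l_v(\phi_{ERM})-l_v(\phi^*)\le\epsilon .$$ -/

import Mathlib

open MeasureTheory

/-! ### Goldberg–Jerrum (GJ) algorithms -/

/-- The arithmetic operations available to a GJ algorithm. -/
inductive GJOp : Type
  | add
  | sub
  | mul
  | div

/-- A GJ algorithm with real inputs indexed by `ι`, in a state where `k` values have already been
computed. Operands (`ι ⊕ Fin k`) are either inputs or previously computed values. Real constants
may be written into the algorithm. -/
inductive GJAlgorithm (ι : Type) : ℕ → Type
  /-- Return an input or a computed value. -/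
  | ret {k : ℕ} (u : ι ⊕ Fin k) : GJAlgorithm ι k
  /-- Write down a real constant and continue. -/
  | const {k : ℕ} (c : ℝ) (next : GJAlgorithm ι (k + 1)) : GJAlgorithm ι k
  /-- Compute `u ⊙ v` and continue. -/
  | arith {k : ℕ} (op : GJOp) (u v : ι ⊕ Fin k) (next : GJAlgorithm ι (k + 1)) : GJAlgorithm ι k
  /-- `if u ≥ 0 then yes else no`. -/
  | cond {k : ℕ} (u : ι ⊕ Fin k) (yes no : GJAlgorithm ι k) : GJAlgorithm ι k

/-- Real arithmetic; division by zero has no result. -/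
noncomputable def GJOp.run : GJOp → ℝ → ℝ → Option ℝ
  | .add, a, c => some (a + c)
  | .sub, a, c => some (a - c)
  | .mul, a, c => some (a * c)
  | .div, a, c => by
      classical exact if c = 0 then none else some (a / c)

/-- The field of rational functions in the inputs. -/
abbrev GJRat (ι : Type) : Type := FractionRing (MvPolynomial ι ℝ)

/-- Arithmetic on rational functions. -/
noncomputable def GJOp.formal {ι : Type} : GJOp → GJRat ι → GJRat ι → GJRat ι
  | .add, p, q => p + q
  | .sub, p, q => p - q
  | .mul, p, q => p * q
  | .div, p, q => p / q

/-- The degree of a rational function: the least `m` for which it is a quotient of two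
polynomials of total degree at most `m`. -/
noncomputable def GJRat.degree {ι : Type} (q : GJRat ι) : ℕ :=
  sInf {m : ℕ | ∃ num den : MvPolynomial ι ℝ, den ≠ 0 ∧ num.totalDegree ≤ m ∧
    den.totalDegree ≤ m ∧
    q = algebraMap (MvPolynomial ι ℝ) (GJRat ι) num / algebraMap (MvPolynomial ι ℝ) (GJRat ι) den}

namespace GJAlgorithm

variable {ι : Type}

/-- Run the algorithm on input `x`, the values computed so far being `vals`. The result is `none`
if a division by zero is met. -/
noncomputable def run (x : ι → ℝ) : {k : ℕ} → GJAlgorithm ι k → (Fin k → ℝ) → Option ℝ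
  | _, .ret u, vals => some (Sum.elim x vals u)
  | _, .const c next, vals => run x next (Fin.snoc vals c)
  | _, .arith op u v next, vals =>
      (op.run (Sum.elim x vals u) (Sum.elim x vals v)).bind fun a => run x next (Fin.snoc vals a)
  | _, .cond u yes no, vals => by
      classical exact if 0 ≤ Sum.elim x vals u then run x yes vals else run x no vals

/-- The value of an operand as a rational function of the inputs. -/
noncomputable def formalValue {k : ℕ} (vals : Fin k → GJRat ι) : ι ⊕ Fin k → GJRat ι :=
  Sum.elim (fun i => algebraMap (MvPolynomial ι ℝ) (GJRat ι) (MvPolynomial.X i)) vals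

/-- The rational functions of the inputs that the algorithm computes, over all its branches. -/
noncomputable def computed : {k : ℕ} → GJAlgorithm ι k → (Fin k → GJRat ι) → Set (GJRat ι)
  | _, .ret u, vals => {formalValue vals u}
  | _, .const c next, vals =>
      let q : GJRat ι := algebraMap (MvPolynomial ι ℝ) (GJRat ι) (MvPolynomial.C c)
      insert q (computed next (Fin.snoc vals q))
  | _, .arith op u v next, vals =>
      let q : GJRat ι := op.formal (formalValue vals u) (formalValue vals v)
      insert q (computed next (Fin.snoc vals q))
  | _, .cond u yes no, vals =>
      insert (formalValue vals u) (computed yes vals ∪ computed no vals)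

/-- The rational functions of the inputs that appear in conditional statements. -/
noncomputable def predicates : {k : ℕ} → GJAlgorithm ι k → (Fin k → GJRat ι) → Set (GJRat ι)
  | _, .ret _, _ => ∅
  | _, .const c next, vals =>
      predicates next
        (Fin.snoc vals (algebraMap (MvPolynomial ι ℝ) (GJRat ι) (MvPolynomial.C c)))
  | _, .arith op u v next, vals =>
      predicates next (Fin.snoc vals (op.formal (formalValue vals u) (formalValue vals v)))
  | _, .cond u yes no, vals =>
      insert (formalValue vals u) (predicates yes vals ∪ predicates no vals)

/-- The degree: the maximum degree of a rational function computed. -/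
noncomputable def degree (A : GJAlgorithm ι 0) : ℕ∞ :=
  ⨆ q ∈ A.computed Fin.elim0, (GJRat.degree q : ℕ∞)

/-- The predicate complexity: the number of distinct rational functions in conditionals. -/
noncomputable def predicateComplexity (A : GJAlgorithm ι 0) : ℕ∞ :=
  (A.predicates Fin.elim0).encard

end GJAlgorithm

/-- `g` is computed by a GJ algorithm of degree at most `Δ` and predicate complexity at
most `Λ`. -/
def GJComputable {ι : Type} (Δ Λ : ℕ) (g : (ι → ℝ) → ℝ) : Prop :=
  ∃ A : GJAlgorithm ι 0, A.degree ≤ Δ ∧ A.predicateComplexity ≤ Λ ∧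
    ∀ x : ι → ℝ, A.run x Fin.elim0 = some (g x)

/-! ### Pseudo-dimension -/

/-- `S` is pseudo-shattered by the class `G`. -/
def PseudoShattered {Z : Type*} (G : Set (Z → ℝ)) (S : Finset Z) : Prop :=
  ∃ t : Z → ℝ, ∀ U ⊆ S, ∃ g ∈ G, ∀ z ∈ S, t z ≤ g z ↔ z ∈ U

/-- The pseudo-dimension: the maximal size of a pseudo-shattered finite set, `⊤` if there is no
maximum. -/
noncomputable def pdim {Z : Type*} (G : Set (Z → ℝ)) : ℕ∞ :=
  ⨆ (S : Finset Z) (_ : PseudoShattered G S), (S.card : ℕ∞)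

/-! ### Langevin gradient descent (LGD) and its validation loss -/

/-- Euclidean space `ℝᵐ`. -/
abbrev Vec (m : ℕ) : Type := EuclideanSpace ℝ (Fin m)

/-- A regression task `(X, y, X_v, y_v)`: `n` training and `nv` validation examples. -/
abbrev RegTask (dx n nv : ℕ) : Type :=
  (Fin n → Vec dx) × (Fin n → ℝ) × (Fin nv → Vec dx) × (Fin nv → ℝ)

/-- Langevin noise: one vector of `ℝᵈ` for each of the `N` steps. -/
abbrev LangevinNoise (N d : ℕ) : Type := Fin N → Vec d

/-- Hyperparameters `φ = (θ, √η)`, with `θ ∈ ℝʰ` and learning rate `η > 0`. -/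
abbrev Hyperparam (h : ℕ) : Type := Vec h × Set.Ioi (0 : ℝ)

/-- The learning rate `η` of `φ = (θ, √η)`. -/
noncomputable def learningRate {h : ℕ} (φ : Hyperparam h) : ℝ := (φ.2 : ℝ) ^ 2

section LGD

variable {dx d h n nv : ℕ}
  (f : Vec dx → Vec d → ℝ) (l : ℝ → ℝ → ℝ) (r : Vec d → Vec h → Vec d)

/-- `∇_w f(X; w) ∇_{y'} l(y, y' = f(X; w)) + r(w; θ)`. The first argument of `l` is the true
output, the second one the prediction. -/
noncomputable def lgdGradient (X : Fin n → Vec dx) (y : Fin n → ℝ) (θ : Vec h) (w : Vec d) :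
    Vec d :=
  (∑ i, deriv (l (y i)) (f (X i) w) • gradient (f (X i)) w) + r w θ

/-- The LGD iterates `w₍ₖ₎`, `k ≤ N`, from `w₍₀₎ = 0`, with noise `ξ` (constant for `k ≥ N`). -/
noncomputable def lgdIterate {N : ℕ} (φ : Hyperparam h) (ξ : LangevinNoise N d)
    (X : Fin n → Vec dx) (y : Fin n → ℝ) : ℕ → Vec d
  | 0 => 0
  | k + 1 =>
    let w := lgdIterate φ ξ X y k
    if hk : k < N then
      w - learningRate φ • lgdGradient f l r X y φ.1 w
        + Real.sqrt (2 * learningRate φ) • ξ ⟨k, hk⟩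
    else w

/-- The LGD prediction at a validation input `xv`: the mean of `f(xv; w₍ₖ₎)` over the `b` steps
following the `B` burn-in steps. -/
noncomputable def lgdPredict (B b : ℕ) (φ : Hyperparam h) (ξ : LangevinNoise (B + b) d)
    (X : Fin n → Vec dx) (y : Fin n → ℝ) (xv : Vec dx) : ℝ :=
  (1 / (b : ℝ)) * ∑ k ∈ Finset.Icc (B + 1) (B + b), f xv (lgdIterate f l r φ ξ X y k)

/-- The validation loss `l_v(φ, ξ, P)` on a task `P = (X, y, X_v, y_v)`. -/
noncomputable def validationLoss (B b : ℕ) (φ : Hyperparam h) (ξ : LangevinNoise (B + b) d)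
    (P : RegTask dx n nv) : ℝ :=
  (1 / (nv : ℝ)) *
    ∑ i, l (P.2.2.2 i) (lgdPredict f l r B b φ ξ P.1 P.2.1 (P.2.2.1 i))

/-- The class `L_v` of functions `l_v(φ, ·, ·)` on noise vectors and tasks in the support
of `D`. -/
def validationLossClass (B b : ℕ) (D : Measure (RegTask dx n nv)) :
    Set (LangevinNoise (B + b) d × D.support → ℝ) :=
  Set.range fun (φ : Hyperparam h) z => validationLoss f l r B b φ z.1 (z.2 : RegTask dx n nv)

/-- The expected validation loss `l_v(φ)` for tasks drawn from `D` and noise drawn from `DE`. -/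
noncomputable def expectedLoss (B b : ℕ) (DE : Measure (LangevinNoise (B + b) d))
    (D : Measure (RegTask dx n nv)) (φ : Hyperparam h) : ℝ :=
  ∫ z, validationLoss f l r B b φ z.1 z.2 ∂(DE.prod D)

/-- The empirical validation loss `l_v(φ, ξ, S)`: the `t`-th entry of the sample consists of the
noise and of the data of the `t`-th task. -/
noncomputable def empiricalLoss (B b : ℕ) {T : ℕ}
    (sample : Fin T → LangevinNoise (B + b) d × RegTask dx n nv) (φ : Hyperparam h) : ℝ :=
  (1 / (T : ℝ)) * ∑ t, validationLoss f l r B b φ (sample t).1 (sample t).2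

end LGD

/-! For a class bounded by C and of pseudo-dimension n, empirical minimization over T samples has
excess risk of order C√((n + log(1/δ))/T), with no factor log T. The dynamics of LGD matter only
through joint measurability of the loss (`measurable_validationLoss`), which comes from the GJ
algorithms and differentiability.

The absence of the logarithm rests on a Haussler-type packing bound, `card_le_of_mean_separated`:
functions pairwise 4⁻ʲ·2C apart in mean number at most exp(4n(j+1)), whatever the size of the index
set. A greedy choice of few thresholds tells them all apart, and Sauer–Shelah limits the number of
traces on these thresholds. Hence nets of Euclidean radius 2C·2⁻ʲ√T have log-size O(n(j+1)), and
chaining Rademacher sums along them gives `card_sup_signSum_le`: a supremum of order C√(T(n+s))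
outside a fraction e⁻ˢ of the sign patterns.

A ghost sample (`measure_selection_le_two_mul_ghost`) and swaps inside the pairs
(`measure_le_of_card_signSwap_le`) carry this over to the excess risk. Both work with the measurable
selection itself, so no uncountable supremum has to be measurable; suprema occur only for a fixed
sample, where sign patterns are counted. `subgraphDimLE_of_pdim_le` supplies the combinatorial
condition on each sample. -/

/-! ### Packing numbers of classes with small shattered sets -/

section Packing

variable {Φ ι : Type*}

/-- The threshold `t` lies between the `i`-th values of `a φ` and `a ψ`. -/
def ThresholdSeparates (a : Φ → ι → ℝ) (z : ι × ℝ) (q : Φ × Φ) : Prop :=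
  ¬(z.2 ≤ a q.1 z.1 ↔ z.2 ≤ a q.2 z.1)

/-- The subset of `S` lying below the graph of `a φ`. -/
noncomputable def subgraphTrace (a : Φ → ι → ℝ) (S : Finset (ι × ℝ)) (φ : Φ) : Finset (ι × ℝ) := by
  classical exact S.filter fun z => z.2 ≤ a φ z.1

/-- Sets of pairs (index, threshold) all of whose subsets are cut out by the class `a` have at
most `n` elements. -/
def SubgraphDimLE (a : Φ → ι → ℝ) (n : ℕ) : Prop :=
  ∀ S : Finset (ι × ℝ), (∀ U ⊆ S, ∃ φ, ∀ z ∈ S, z.2 ≤ a φ z.1 ↔ z ∈ U) → S.card ≤ n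

lemma integral_indicator_threshold {C x y : ℝ} (hx : |x| ≤ C) (hy : |y| ≤ C) :
    ∫ t in Set.Ioc (-C) C, (Set.uIoc x y).indicator (fun _ => (1 : ℝ)) t = |x - y| := by
  rw [setIntegral_indicator measurableSet_uIoc, Set.inter_eq_right.2]
  · simp only [integral_const, MeasurableSet.univ, measureReal_restrict_apply, Set.univ_inter,
      smul_eq_mul, mul_one]
    rw [Measure.real, Set.uIoc, Real.volume_Ioc, ENNReal.toReal_ofReal (by simp),
      max_sub_min_eq_abs, abs_sub_comm]
  · rw [abs_le] at hx hy
    exact Set.Ioc_subset_Ioc (le_min hx.1 hy.1) (max_le hx.2 hy.2)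

lemma mem_uIoc_iff_threshold {x y t : ℝ} : t ∈ Set.uIoc x y ↔ ¬(t ≤ x ↔ t ≤ y) := by
  rw [Set.mem_uIoc]
  constructor
  · rintro (⟨h1, h2⟩ | ⟨h1, h2⟩) h
    · exact absurd (h.2 h2) (not_le.2 h1)
    · exact absurd (h.1 h2) (not_le.2 h1)
  · intro h
    by_cases h1 : t ≤ x <;> by_cases h2 : t ≤ y <;> simp_all

open Classical in
-- First moment, twice: some index does at least as well as the average index, and then some
-- threshold in (-C, C] as well as the average threshold. The distance of two values is the length
-- of the set of thresholds between them, so a uniform threshold separates a pair with probability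
-- |x - y| / (2C).
lemma exists_threshold_separating [Fintype ι] [Nonempty ι] (a : Φ → ι → ℝ) {C p : ℝ} (hC : 0 < C)
    (ha : ∀ φ i, |a φ i| ≤ C) (Q : Finset (Φ × Φ))
    (hQ : ∀ q ∈ Q, p * (2 * C) * Fintype.card ι ≤ ∑ i, |a q.1 i - a q.2 i|) :
    ∃ z : ι × ℝ, p * Q.card ≤ (Q.filter (ThresholdSeparates a z)).card := by
  set g : ι → ℝ → ℝ := fun i t =>
    ∑ q ∈ Q, (Set.uIoc (a q.1 i) (a q.2 i)).indicator (fun _ => (1 : ℝ)) t with hg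
  have hvol : volume (Set.Ioc (-C) C) = ENNReal.ofReal (2 * C) := by
    rw [Real.volume_Ioc]; congr 1; ring
  have hint1 : ∀ i, ∀ q : Φ × Φ, IntegrableOn
      ((Set.uIoc (a q.1 i) (a q.2 i)).indicator (fun _ => (1 : ℝ))) (Set.Ioc (-C) C) := by
    intro i q
    refine IntegrableOn.indicator ?_ measurableSet_uIoc
    exact integrableOn_const (by rw [hvol]; exact ENNReal.ofReal_ne_top)
  have hint : ∀ i, IntegrableOn (g i) (Set.Ioc (-C) C) := fun i =>
    integrable_finsetSum _ fun q _ => hint1 i q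
  have hgi : ∀ i, ∫ t in Set.Ioc (-C) C, g i t = ∑ q ∈ Q, |a q.1 i - a q.2 i| := by
    intro i
    rw [hg, integral_finsetSum _ fun q _ => hint1 i q]
    exact Finset.sum_congr rfl fun q _ => integral_indicator_threshold (ha _ _) (ha _ _)
  obtain ⟨i, -, hi⟩ : ∃ i ∈ (Finset.univ : Finset ι),
      p * (2 * C) * Q.card ≤ ∑ q ∈ Q, |a q.1 i - a q.2 i| := by
    apply Finset.exists_le_of_sum_le Finset.univ_nonempty
    rw [Finset.sum_comm, Finset.sum_const, Finset.card_univ, nsmul_eq_mul]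
    calc (Fintype.card ι : ℝ) * (p * (2 * C) * Q.card)
        = ∑ q ∈ Q, p * (2 * C) * Fintype.card ι := by
          rw [Finset.sum_const, nsmul_eq_mul]; ring
      _ ≤ _ := Finset.sum_le_sum hQ
  obtain ⟨t, -, ht⟩ := exists_setAverage_le (μ := volume) (s := Set.Ioc (-C) C) (f := g i)
    (by rw [hvol]; simp [hC]) (by rw [hvol]; exact ENNReal.ofReal_ne_top) (hint i)
  refine ⟨(i, t), ?_⟩
  have h1 : g i t = ((Q.filter (ThresholdSeparates a (i, t))).card : ℝ) := by
    rw [Finset.card_filter, Nat.cast_sum]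
    refine Finset.sum_congr rfl fun q _ => ?_
    by_cases h : ThresholdSeparates a (i, t) q
    · rw [if_pos h, Set.indicator_of_mem (mem_uIoc_iff_threshold.2 h), Nat.cast_one]
    · rw [if_neg h, Set.indicator_of_notMem (fun h' => h (mem_uIoc_iff_threshold.1 h')),
        Nat.cast_zero]
  rw [← h1]
  refine le_trans ?_ ht
  rw [setAverage_eq, hgi, Measure.real, hvol, ENNReal.toReal_ofReal (by positivity), smul_eq_mul,
    inv_mul_eq_div, le_div_iff₀ (by positivity)]
  linarith

open Classical in
-- Greedy choice: each new threshold separates at least a fraction p of the pairs that are still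
-- unseparated.
lemma exists_finset_threshold_separating [Fintype ι] [Nonempty ι] (a : Φ → ι → ℝ) {C p : ℝ} (hC : 0 < C)
    (hp : p ≤ 1) (ha : ∀ φ i, |a φ i| ≤ C) (Q : Finset (Φ × Φ))
    (hQ : ∀ q ∈ Q, p * (2 * C) * Fintype.card ι ≤ ∑ i, |a q.1 i - a q.2 i|) (m : ℕ) :
    ∃ S : Finset (ι × ℝ), S.card ≤ m ∧
      ((Q.filter fun q => ∀ z ∈ S, ¬ThresholdSeparates a z q).card : ℝ) ≤
        (1 - p) ^ m * Q.card := by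
  induction m with
  | zero => exact ⟨∅, by simp, by simp⟩
  | succ m ih =>
    obtain ⟨S, hS, hcard⟩ := ih
    set Q' := Q.filter fun q => ∀ z ∈ S, ¬ThresholdSeparates a z q with hQ'
    obtain ⟨z, hz⟩ := exists_threshold_separating a hC ha Q'
      fun q hq => hQ q (Finset.mem_filter.1 hq).1
    refine ⟨insert z S, (Finset.card_insert_le _ _).trans (by omega), ?_⟩
    have h1 : (Q.filter fun q => ∀ z' ∈ insert z S, ¬ThresholdSeparates a z' q) =
        Q'.filter fun q => ¬ThresholdSeparates a z q := by
      ext q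
      simp only [hQ', Finset.mem_filter, Finset.forall_mem_insert]
      tauto
    have h2 := Finset.card_filter_add_card_filter_not (s := Q') (ThresholdSeparates a z)
    have h3 : ((Q'.filter (ThresholdSeparates a z)).card : ℝ) +
        ((Q'.filter fun q => ¬ThresholdSeparates a z q).card : ℝ) = Q'.card := by
      exact_mod_cast h2
    rw [h1, pow_succ]
    have h4 : (1 - p) * (Q'.card : ℝ) ≤ (1 - p) * ((1 - p) ^ m * Q.card) :=
      mul_le_mul_of_nonneg_left hcard (by linarith)
    nlinarith

open Classical in
-- Sauer–Shelah in generating-function form: traces are at most as many as shattered subsets of S,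
-- these have at most n elements, and weighting each by x to its size gives part of the binomial
-- sum. The free parameter x makes the cost of a large S only about x · |S| in the logarithm.
lemma card_mul_pow_le_of_subgraphTrace_injOn (a : Φ → ι → ℝ) {n : ℕ} (hdim : SubgraphDimLE a n)
    (F : Finset Φ) (S : Finset (ι × ℝ)) (hinj : Set.InjOn (subgraphTrace a S) F) {x : ℝ}
    (hx : 0 ≤ x) (hx1 : x ≤ 1) : (F.card : ℝ) * x ^ n ≤ (1 + x) ^ S.card := by
  set 𝒜 := F.image (subgraphTrace a S) with h𝒜
  have hcard : 𝒜.card = F.card := Finset.card_image_of_injOn hinj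
  have hsub : 𝒜.shatterer ⊆ S.powerset.filter fun s => s.card ≤ n := by
    intro s hs
    rw [Finset.mem_shatterer] at hs
    have hsS : s ⊆ S := by
      obtain ⟨u, hu, hsu⟩ := hs (Finset.Subset.refl s)
      obtain ⟨φ, -, rfl⟩ := Finset.mem_image.1 hu
      exact (Finset.inter_eq_left.1 hsu).trans (Finset.filter_subset _ _)
    refine Finset.mem_filter.2 ⟨Finset.mem_powerset.2 hsS, hdim s fun U hU => ?_⟩
    obtain ⟨u, hu, hsu⟩ := hs hU
    obtain ⟨φ, -, rfl⟩ := Finset.mem_image.1 hu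
    refine ⟨φ, fun z hz => ?_⟩
    rw [← hsu, Finset.mem_inter, subgraphTrace, Finset.mem_filter]
    exact ⟨fun h => ⟨hz, hsS hz, h⟩, fun h => h.2.2⟩
  calc (F.card : ℝ) * x ^ n
      ≤ ((S.powerset.filter fun s => s.card ≤ n).card : ℝ) * x ^ n := by
        refine mul_le_mul_of_nonneg_right ?_ (by positivity)
        rw [← hcard]
        exact_mod_cast 𝒜.card_le_card_shatterer.trans (Finset.card_le_card hsub)
    _ = ∑ s ∈ S.powerset.filter (fun s => s.card ≤ n), x ^ n := by
        rw [Finset.sum_const, nsmul_eq_mul]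
    _ ≤ ∑ s ∈ S.powerset.filter (fun s => s.card ≤ n), x ^ s.card :=
        Finset.sum_le_sum fun s hs => pow_le_pow_of_le_one hx hx1 (Finset.mem_filter.1 hs).2
    _ ≤ ∑ s ∈ S.powerset, x ^ s.card :=
        Finset.sum_le_sum_of_subset_of_nonneg (Finset.filter_subset _ _)
          fun _ _ _ => by positivity
    _ = (1 + x) ^ S.card := by
        rw [add_comm, ← Finset.sum_pow_mul_eq_add_pow]
        simp

/-- A family of functions which are pairwise separated in mean has cardinality polynomial in the
separation, with exponent proportional to the dimension of the subgraphs. -/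
lemma card_le_of_mean_separated [Fintype ι] [Nonempty ι] (a : Φ → ι → ℝ) {n : ℕ} (hn : 1 ≤ n)
    (hdim : SubgraphDimLE a n) {C : ℝ} (hC : 0 < C) (ha : ∀ φ i, |a φ i| ≤ C) (j : ℕ)
    (F : Finset Φ)
    (hF : (F : Set Φ).Pairwise fun φ ψ =>
      (1 / 4 : ℝ) ^ j * (2 * C) * Fintype.card ι ≤ ∑ i, |a φ i - a ψ i|) :
    (F.card : ℝ) ≤ Real.exp (4 * n * (j + 1)) := by
  classical
  rcases F.eq_empty_or_nonempty with rfl | hne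
  · simp [Real.exp_nonneg]
  set p : ℝ := (1 / 4 : ℝ) ^ j with hp
  have hp0 : 0 < p := by positivity
  have hp1 : p ≤ 1 := pow_le_one₀ (by norm_num) (by norm_num)
  have hM : (1 : ℝ) ≤ F.card := by exact_mod_cast hne.card_pos
  set M : ℝ := (F.card : ℝ) with hMdef
  have hlogM : 0 ≤ Real.log M := Real.log_nonneg hM
  -- Just enough thresholds for (1 - p)ᵐ M² < 1, so that no pair stays unseparated. This number
  -- depends on M and p but not on the size of `ι`.
  set m : ℕ := ⌊2 * Real.log M / p⌋₊ + 1 with hm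
  have hm1 : 2 * Real.log M < p * m := by
    have := Nat.lt_floor_add_one (2 * Real.log M / p)
    rw [div_lt_iff₀ hp0] at this
    rw [hm]; push_cast; linarith
  have hm2 : p * m ≤ 2 * Real.log M + p := by
    have := Nat.floor_le (a := 2 * Real.log M / p) (by positivity)
    rw [le_div_iff₀ hp0] at this
    rw [hm]; push_cast; linarith
  obtain ⟨S, hSm, hS⟩ := exists_finset_threshold_separating a hC hp1 ha F.offDiag
    (by
      intro q hq
      rw [Finset.mem_offDiag] at hq
      exact hF hq.1 hq.2.1 hq.2.2) m
  have hoff : (F.offDiag.card : ℝ) ≤ M ^ 2 := by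
    rw [Finset.offDiag_card, hMdef]
    calc ((F.card * F.card - F.card : ℕ) : ℝ) ≤ ((F.card * F.card : ℕ) : ℝ) := by
          exact_mod_cast Nat.sub_le _ _
      _ = _ := by push_cast; ring
  have hlt : (1 - p) ^ m * (F.offDiag.card : ℝ) < 1 := by
    have h1 : (1 - p) ^ m ≤ Real.exp (-(p * m)) := by
      calc (1 - p) ^ m ≤ (Real.exp (-p)) ^ m :=
            pow_le_pow_left₀ (by linarith) (Real.one_sub_le_exp_neg p) m
        _ = _ := by rw [← Real.exp_nat_mul]; ring_nf
    calc (1 - p) ^ m * (F.offDiag.card : ℝ) ≤ Real.exp (-(p * m)) * M ^ 2 :=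
          mul_le_mul h1 hoff (by positivity) (Real.exp_nonneg _)
      _ < Real.exp (-(2 * Real.log M)) * M ^ 2 := by
          have : Real.exp (-(p * m)) < Real.exp (-(2 * Real.log M)) :=
            Real.exp_lt_exp.2 (by linarith)
          exact mul_lt_mul_of_pos_right this (by positivity)
      _ = 1 := by
          rw [Real.exp_neg, two_mul, Real.exp_add, Real.exp_log (by linarith)]
          field_simp
  have hinj : Set.InjOn (subgraphTrace a S) F := by
    intro φ hφ ψ hψ h
    by_contra hne
    have hempty := hS.trans_lt hlt
    rw [Nat.cast_lt_one, Finset.card_eq_zero] at hempty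
    have hmem : (φ, ψ) ∈ F.offDiag.filter fun q => ∀ z ∈ S, ¬ThresholdSeparates a z q := by
      refine Finset.mem_filter.2 ⟨Finset.mem_offDiag.2 ⟨hφ, hψ, hne⟩, fun z hz => ?_⟩
      have := Finset.ext_iff.1 h z
      simp only [subgraphTrace, Finset.mem_filter, hz, true_and] at this
      simpa [ThresholdSeparates] using this
    rw [hempty] at hmem
    simp at hmem
  -- With x = p / 4 the right side has logarithm at most p m / 4 ≤ (log M) / 2 + p / 4. Half of log
  -- M is absorbed on the left, leaving log M ≤ 2n log(4 / p) + p / 2.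
  have hmain := card_mul_pow_le_of_subgraphTrace_injOn a hdim F S hinj (x := p / 4)
    (by positivity) (by linarith)
  have h5 : M * (p / 4) ^ n ≤ Real.exp (p / 4 * m) := by
    calc M * (p / 4) ^ n ≤ (1 + p / 4) ^ S.card := hmain
      _ ≤ (1 + p / 4) ^ m := pow_le_pow_right₀ (by linarith) hSm
      _ ≤ (Real.exp (p / 4)) ^ m := by
          refine pow_le_pow_left₀ (by linarith) ?_ m
          linarith [Real.add_one_le_exp (p / 4)]
      _ = _ := by rw [← Real.exp_nat_mul]; ring_nf
  have h6 : Real.log M + n * Real.log (p / 4) ≤ p / 4 * m := by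
    rw [← Real.log_pow, ← Real.log_mul (by positivity) (by positivity)]
    exact (Real.log_le_iff_le_exp (by positivity)).2 h5
  have h7 : Real.log (p / 4) = -((j + 1) * (2 * Real.log 2)) := by
    have : p / 4 = ((2 : ℝ) ^ (2 * (j + 1)))⁻¹ := by
      rw [hp, pow_mul, pow_succ, one_div_pow, mul_inv]; norm_num [div_eq_mul_inv]
    rw [this, Real.log_inv, Real.log_pow]; push_cast; ring
  rw [← Real.log_le_iff_le_exp (by linarith)]
  rw [h7] at h6
  have hn' : (1 : ℝ) ≤ n := by exact_mod_cast hn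
  have hj : (0 : ℝ) ≤ j := by positivity
  have hl2 := Real.log_two_lt_d9
  have h8 : (1 : ℝ) ≤ n * (j + 1) := by nlinarith
  have h9 : (n : ℝ) * (j + 1) * Real.log 2 ≤ (n : ℝ) * (j + 1) * 0.7 :=
    mul_le_mul_of_nonneg_left (by linarith) (by positivity)
  nlinarith

end Packing

/-! ### Rademacher sums and chaining -/

section Rademacher

variable {Φ ι : Type*} [Fintype ι]

/-- The sum of the entries of `v` with signs `σ`. -/
def signSum (σ : ι → Bool) (v : ι → ℝ) : ℝ :=
  ∑ i, (if σ i then v i else -v i)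

lemma signSum_sub (σ : ι → Bool) (v w : ι → ℝ) :
    signSum σ (v - w) = signSum σ v - signSum σ w := by
  rw [signSum, signSum, signSum, ← Finset.sum_sub_distrib]
  refine Finset.sum_congr rfl fun i _ => ?_
  split_ifs
  · simp
  · simp
    ring

lemma signSum_not (σ : ι → Bool) (v : ι → ℝ) : signSum (fun i => !σ i) v = -signSum σ v := by
  rw [signSum, signSum, ← Finset.sum_neg_distrib]
  refine Finset.sum_congr rfl fun i _ => ?_
  cases σ i <;> simp

/-- The exponential moment factors over the coordinates, and cosh x ≤ exp(x² / 2). -/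
lemma sum_exp_signSum_le [DecidableEq ι] (v : ι → ℝ) (t : ℝ) :
    ∑ σ : ι → Bool, Real.exp (t * signSum σ v) ≤
      2 ^ Fintype.card ι * Real.exp (t ^ 2 * (∑ i, v i ^ 2) / 2) := by
  have h1 : ∀ σ : ι → Bool, Real.exp (t * signSum σ v) =
      ∏ i, Real.exp (t * if σ i then v i else -v i) := by
    intro σ
    rw [← Real.exp_sum, signSum, Finset.mul_sum]
  calc ∑ σ : ι → Bool, Real.exp (t * signSum σ v)
      = ∏ i, ∑ b : Bool, Real.exp (t * if b then v i else -v i) := by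
        rw [Finset.prod_univ_sum, Fintype.piFinset_univ]
        exact Finset.sum_congr rfl fun σ _ => h1 σ
    _ = ∏ i, (2 * Real.cosh (t * v i)) := by
        refine Finset.prod_congr rfl fun i _ => ?_
        rw [Fintype.sum_bool, Real.cosh_eq]
        simp
        ring
    _ ≤ ∏ i, (2 * Real.exp ((t * v i) ^ 2 / 2)) :=
        Finset.prod_le_prod (fun i _ => by positivity) fun i _ =>
          mul_le_mul_of_nonneg_left (Real.cosh_le_exp_half_sq _) (by norm_num)
    _ = _ := by
        rw [Finset.prod_mul_distrib, ← Real.exp_sum, Finset.prod_const, Finset.card_univ,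
          Finset.mul_sum, Finset.sum_div]
        simp only [mul_pow]

/-- Chernoff's bound, with the parameter t = u / V that minimizes t² V / 2 - t u. -/
lemma card_signSum_gt_le [DecidableEq ι] (v : ι → ℝ) {u V : ℝ} (hu : 0 ≤ u) (hV : 0 < V)
    (hv : ∑ i, v i ^ 2 ≤ V) :
    ((Finset.univ.filter fun σ : ι → Bool => u < signSum σ v).card : ℝ) ≤
      2 ^ Fintype.card ι * Real.exp (-(u ^ 2 / (2 * V))) := by
  set t := u / V
  have ht : 0 ≤ t := by positivity
  have h1 : ((Finset.univ.filter fun σ : ι → Bool => u < signSum σ v).card : ℝ) *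
      Real.exp (t * u) ≤ 2 ^ Fintype.card ι * Real.exp (t ^ 2 * V / 2) := by
    calc _ = ∑ σ ∈ Finset.univ.filter (fun σ : ι → Bool => u < signSum σ v),
          Real.exp (t * u) := by rw [Finset.sum_const, nsmul_eq_mul]
      _ ≤ ∑ σ ∈ Finset.univ.filter (fun σ : ι → Bool => u < signSum σ v),
          Real.exp (t * signSum σ v) := by
          refine Finset.sum_le_sum fun σ hσ => Real.exp_le_exp.2 ?_
          exact mul_le_mul_of_nonneg_left (Finset.mem_filter.1 hσ).2.le ht
      _ ≤ ∑ σ, Real.exp (t * signSum σ v) :=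
          Finset.sum_le_sum_of_subset_of_nonneg (Finset.filter_subset _ _)
            fun _ _ _ => Real.exp_nonneg _
      _ ≤ _ := sum_exp_signSum_le v t
      _ ≤ _ := by gcongr
  rw [← le_div_iff₀ (Real.exp_pos _), mul_div_assoc, ← Real.exp_sub] at h1
  refine h1.trans_eq ?_
  congr 2
  simp only [t]
  field_simp
  ring

lemma abs_signSum_le (σ : ι → Bool) (v : ι → ℝ) : |signSum σ v| ≤ ∑ i, |v i| := by
  refine (Finset.abs_sum_le_sum_abs _ _).trans (Finset.sum_le_sum fun i _ => ?_)
  split_ifs <;> simp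

lemma sum_abs_le_sqrt_card_mul (v : ι → ℝ) :
    ∑ i, |v i| ≤ √(Fintype.card ι) * √(∑ i, v i ^ 2) := by
  have h := Real.sum_mul_le_sqrt_mul_sqrt Finset.univ (fun _ : ι => (1 : ℝ)) fun i => |v i|
  simpa using h

/-! ### Euclidean nets at dyadic scales -/

/-- The Euclidean distance of two functions on a finite set. -/
noncomputable def euclDist (v w : ι → ℝ) : ℝ := dist (WithLp.toLp 2 v) (WithLp.toLp 2 w)

lemma euclDist_eq (v w : ι → ℝ) : euclDist v w = √(∑ i, (v i - w i) ^ 2) := by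
  simp [euclDist, EuclideanSpace.dist_eq, Real.dist_eq]

lemma euclDist_sq (v w : ι → ℝ) : euclDist v w ^ 2 = ∑ i, (v i - w i) ^ 2 := by
  rw [euclDist_eq, Real.sq_sqrt (Finset.sum_nonneg fun _ _ => sq_nonneg _)]

lemma euclDist_comm (v w : ι → ℝ) : euclDist v w = euclDist w v := dist_comm _ _

lemma euclDist_triangle (u v w : ι → ℝ) : euclDist u w ≤ euclDist u v + euclDist v w :=
  dist_triangle _ _ _

lemma euclDist_nonneg (v w : ι → ℝ) : 0 ≤ euclDist v w := dist_nonneg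

lemma euclDist_le_of_bounded {C : ℝ} (hC : 0 ≤ C) {v w : ι → ℝ} (hv : ∀ i, |v i| ≤ C)
    (hw : ∀ i, |w i| ≤ C) : euclDist v w ≤ 2 * C * √(Fintype.card ι) := by
  rw [euclDist_eq]
  refine Real.sqrt_le_iff.2 ⟨by positivity, ?_⟩
  rw [mul_pow, Real.sq_sqrt (by positivity)]
  calc ∑ i, (v i - w i) ^ 2 ≤ ∑ _i : ι, (2 * C) ^ 2 := by
        refine Finset.sum_le_sum fun i _ => sq_le_sq' ?_ ?_ <;>
        linarith [abs_le.1 (hv i), abs_le.1 (hw i)]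
    _ = _ := by rw [Finset.sum_const, Finset.card_univ, nsmul_eq_mul]; ring

/-- A separated subset of maximal size is a net. Since values differ by at most 2C, the squared
distance is at most 2C times the ℓ¹ distance; so separation at scale 2⁻ʲ in ℓ² gives separation at
scale 4⁻ʲ in mean, and the packing bound applies. -/
lemma exists_euclDist_net [Nonempty ι] (a : Φ → ι → ℝ) {n : ℕ} (hn : 1 ≤ n)
    (hdim : SubgraphDimLE a n) {C : ℝ} (hC : 0 < C) (ha : ∀ φ i, |a φ i| ≤ C) (F : Finset Φ)
    (j : ℕ) :
    ∃ N ⊆ F, (N.card : ℝ) ≤ Real.exp (4 * n * (j + 1)) ∧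
      ∀ φ ∈ F, ∃ ψ ∈ N, euclDist (a φ) (a ψ) ≤ 2 * C * (1 / 2) ^ j * √(Fintype.card ι) := by
  classical
  set r : ℝ := 2 * C * (1 / 2) ^ j * √(Fintype.card ι) with hr
  have hr0 : 0 ≤ r := by positivity
  set P : Φ → Φ → Prop := fun φ ψ => r < euclDist (a φ) (a ψ) with hP
  have hsymm : Std.Symm P := ⟨fun φ ψ h => by simpa only [hP, euclDist_comm] using h⟩
  obtain ⟨N, hN, hmax⟩ := Finset.exists_max_image
    (F.powerset.filter fun N : Finset Φ => (N : Set Φ).Pairwise P) Finset.card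
    ⟨∅, by simp⟩
  simp only [Finset.mem_filter, Finset.mem_powerset] at hN hmax
  refine ⟨N, hN.1, ?_, fun φ hφ => ?_⟩
  · refine card_le_of_mean_separated a hn hdim hC ha j N fun φ hφ ψ hψ hne => ?_
    have h1 : r ^ 2 ≤ ∑ i, (a φ i - a ψ i) ^ 2 := by
      rw [← euclDist_sq]
      exact pow_le_pow_left₀ hr0 (hN.2 hφ hψ hne).le 2
    have h2 : ∑ i, (a φ i - a ψ i) ^ 2 ≤ 2 * C * ∑ i, |a φ i - a ψ i| := by
      rw [Finset.mul_sum]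
      refine Finset.sum_le_sum fun i _ => ?_
      rw [← sq_abs, sq]
      refine mul_le_mul_of_nonneg_right ?_ (abs_nonneg _)
      calc |a φ i - a ψ i| ≤ |a φ i| + |a ψ i| := abs_sub _ _
        _ ≤ 2 * C := by linarith [ha φ i, ha ψ i]
    have h3 : r ^ 2 = 2 * C * ((1 / 4 : ℝ) ^ j * (2 * C) * Fintype.card ι) := by
      rw [hr, mul_pow, Real.sq_sqrt (by positivity), mul_pow, ← pow_mul, mul_comm j 2, pow_mul]
      norm_num
      ring
    rw [h3] at h1
    exact le_of_mul_le_mul_left (h1.trans h2) (by positivity)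
  · by_contra! hcon
    have hφN : φ ∉ N := fun h => by
      have := hcon φ h
      rw [euclDist, dist_self] at this
      exact absurd this (not_lt.2 hr0)
    have := hmax (insert φ N) ⟨Finset.insert_subset hφ hN.1, by
      rw [Finset.coe_insert]
      exact (Set.pairwise_insert_of_symm).2 ⟨hN.2, fun ψ hψ _ => hcon ψ hψ⟩⟩
    rw [Finset.card_insert_of_notMem hφN] at this
    omega

/-- At level 0 the radius 2C√T exceeds every distance, so the single point φ₀ is a net; every chain
therefore starts at φ₀. -/
lemma exists_euclDist_net_maps [Nonempty ι] (a : Φ → ι → ℝ) {n : ℕ} (hn : 1 ≤ n)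
    (hdim : SubgraphDimLE a n) {C : ℝ} (hC : 0 < C) (ha : ∀ φ i, |a φ i| ≤ C) (F : Finset Φ)
    (φ₀ : Φ) :
    ∃ (N : ℕ → Finset Φ) (π : ℕ → Φ → Φ), (∀ φ, π 0 φ = φ₀) ∧
      ∀ j : ℕ, ((N j).card : ℝ) ≤ Real.exp (4 * n * (j + 1)) ∧
        ∀ φ ∈ F, π j φ ∈ N j ∧
          euclDist (a φ) (a (π j φ)) ≤ 2 * C * (1 / 2) ^ j * √(Fintype.card ι) := by
  classical
  have h : ∀ j : ℕ, ∃ (N : Finset Φ) (π : Φ → Φ), (j = 0 → ∀ φ, π φ = φ₀) ∧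
      (N.card : ℝ) ≤ Real.exp (4 * n * (j + 1)) ∧ ∀ φ ∈ F, π φ ∈ N ∧
          euclDist (a φ) (a (π φ)) ≤ 2 * C * (1 / 2) ^ j * √(Fintype.card ι) := by
    intro j
    rcases j with _ | j
    · refine ⟨{φ₀}, fun _ => φ₀, fun _ _ => rfl, ?_, fun φ _ => ⟨by simp, ?_⟩⟩
      · simp only [Finset.card_singleton, Nat.cast_one]
        exact Real.one_le_exp (by positivity)
      · simpa using euclDist_le_of_bounded hC.le (ha φ) (ha φ₀)
    · obtain ⟨N, -, hN, hφ⟩ := exists_euclDist_net a hn hdim hC ha F (j + 1)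
      choose! π hπ using hφ
      exact ⟨N, π, fun h => by omega, hN, hπ⟩
  choose N π h0 hcard hπ using h
  exact ⟨N, π, h0 0 rfl, fun j => ⟨hcard j, hπ j⟩⟩

/-! ### Chaining -/

lemma sum_range_succ_mul_half_pow_le (J : ℕ) :
    ∑ j ∈ Finset.range J, ((j : ℝ) + 1) * (1 / 2) ^ j ≤ 4 := by
  have h : ∑ j ∈ Finset.range J, ((j : ℝ) + 1) * (1 / 2) ^ j =
      4 - (2 * J + 4) * (1 / 2) ^ J := by
    induction J with
    | zero => norm_num
    | succ J ih => rw [Finset.sum_range_succ, ih, pow_succ]; push_cast; ring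
  rw [h]
  have : (0 : ℝ) ≤ (2 * J + 4) * (1 / 2) ^ J := by positivity
  linarith

lemma sum_range_half_pow_succ_le (J : ℕ) :
    ∑ j ∈ Finset.range J, (1 / 2 : ℝ) ^ (j + 1) ≤ 1 := by
  have h : ∑ j ∈ Finset.range J, (1 / 2 : ℝ) ^ (j + 1) = 1 - (1 / 2) ^ J := by
    induction J with
    | zero => norm_num
    | succ J ih => rw [Finset.sum_range_succ, ih, pow_succ]; ring
  rw [h]
  have : (0 : ℝ) ≤ (1 / 2) ^ J := by positivity
  linarith

lemma signSum_telescope (a : Φ → ι → ℝ) (π : ℕ → Φ) (σ : ι → Bool) (J : ℕ) :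
    signSum σ (a (π J) - a (π 0)) =
      ∑ j ∈ Finset.range J, signSum σ (a (π (j + 1)) - a (π j)) := by
  simp only [signSum_sub]
  rw [Finset.sum_range_sub fun j => signSum σ (a (π j))]

open Classical in
/-- The sign patterns for which some link of the chain at level `j` is large. -/
lemma card_link_le [Nonempty ι] (a : Φ → ι → ℝ) {n : ℕ} (hn : 1 ≤ n) {C : ℝ}
    (hC : 0 < C) {s : ℝ} (hs : 0 ≤ s) (N : ℕ → Finset Φ)
    (hN : ∀ j, ((N j).card : ℝ) ≤ Real.exp (4 * n * (j + 1))) (j : ℕ) :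
    ((Finset.univ.filter fun σ : ι → Bool => ∃ φ ∈ N (j + 1), ∃ ψ ∈ N j,
        euclDist (a φ) (a ψ) ≤ 3 * C * (1 / 2) ^ j * √(Fintype.card ι) ∧
        3 * C * √(Fintype.card ι) * √(2 * (13 * n + s)) * ((j + 1) * (1 / 2) ^ j) <
          signSum σ (a φ - a ψ)).card : ℝ) ≤
      2 ^ Fintype.card ι * (Real.exp (-s) * (1 / 2) ^ (j + 1)) := by
  set T : ℝ := (Fintype.card ι : ℝ)
  have hT : 0 < T := by simp only [T]; exact_mod_cast Fintype.card_pos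
  set V : ℝ := (3 * C * (1 / 2) ^ j * √T) ^ 2 with hV
  set u : ℝ := 3 * C * √T * √(2 * (13 * n + s)) * ((j + 1) * (1 / 2) ^ j) with hu
  have hV0 : 0 < V := by positivity
  have hu0 : 0 ≤ u := by positivity
  have hn' : (1 : ℝ) ≤ n := by exact_mod_cast hn
  have hj : (0 : ℝ) ≤ j := by positivity
  set links := ((N (j + 1)) ×ˢ (N j)).filter fun q : Φ × Φ =>
    euclDist (a q.1) (a q.2) ≤ 3 * C * (1 / 2) ^ j * √T
  have hlinks : (links.card : ℝ) ≤ Real.exp (n * (8 * j + 12)) := by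
    calc (links.card : ℝ) ≤ (((N (j + 1)) ×ˢ (N j)).card : ℝ) := by
          exact_mod_cast Finset.card_filter_le _ _
      _ = (N (j + 1)).card * (N j).card := by rw [Finset.card_product]; push_cast; ring
      _ ≤ Real.exp (4 * n * ((j + 1 : ℕ) + 1)) * Real.exp (4 * n * (j + 1)) :=
          mul_le_mul (hN _) (hN _) (by positivity) (Real.exp_nonneg _)
      _ = _ := by rw [← Real.exp_add]; push_cast; ring_nf
  -- The factor j + 1 in the threshold makes the exponent quadratic in the level, beating the linear
  -- growth of the log-number of links.
  have huV : u ^ 2 / (2 * V) = (13 * n + s) * (j + 1) ^ 2 := by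
    rw [hu, hV]
    have : √(2 * (13 * n + s)) ^ 2 = 2 * (13 * n + s) := Real.sq_sqrt (by positivity)
    rw [div_eq_iff (by positivity)]
    simp only [mul_pow, this]
    ring
  have hone : ∀ q ∈ links, ((Finset.univ.filter fun σ : ι → Bool =>
      u < signSum σ (a q.1 - a q.2)).card : ℝ) ≤
        2 ^ Fintype.card ι * Real.exp (-((13 * n + s) * (j + 1) ^ 2)) := by
    intro q hq
    rw [← huV]
    refine card_signSum_gt_le _ hu0 hV0 ?_
    have := pow_le_pow_left₀ (euclDist_nonneg _ _) (Finset.mem_filter.1 hq).2 2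
    rwa [euclDist_sq] at this
  calc _ ≤ ((links.biUnion fun q => Finset.univ.filter fun σ : ι → Bool =>
        u < signSum σ (a q.1 - a q.2)).card : ℝ) := by
        refine Nat.cast_le.2 (Finset.card_le_card fun σ hσ => ?_)
        simp only [Finset.mem_filter] at hσ
        obtain ⟨-, φ, hφ, ψ, hψ, h1, h2⟩ := hσ
        refine Finset.mem_biUnion.2 ⟨(φ, ψ), Finset.mem_filter.2 ⟨?_, h1⟩, ?_⟩
        · exact Finset.mem_product.2 ⟨hφ, hψ⟩
        · exact Finset.mem_filter.2 ⟨Finset.mem_univ _, h2⟩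
    _ ≤ ∑ q ∈ links, ((Finset.univ.filter fun σ : ι → Bool =>
        u < signSum σ (a q.1 - a q.2)).card : ℝ) := by
        exact_mod_cast Finset.card_biUnion_le
    _ ≤ links.card * (2 ^ Fintype.card ι * Real.exp (-((13 * n + s) * (j + 1) ^ 2))) := by
        rw [← nsmul_eq_mul]; exact Finset.sum_le_card_nsmul _ _ _ hone
    _ ≤ Real.exp (n * (8 * j + 12)) *
        (2 ^ Fintype.card ι * Real.exp (-((13 * n + s) * (j + 1) ^ 2))) := by gcongr
    _ = 2 ^ Fintype.card ι * Real.exp (n * (8 * j + 12) - (13 * n + s) * (j + 1) ^ 2) := by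
        rw [sub_eq_add_neg, Real.exp_add]; ring
    -- Of the 13n, twelve parts pay for the links, as 8j + 12 ≤ 12(j+1)²; the last gives the factor
    -- e^{-(j+1)}, summable over the levels.
    _ ≤ 2 ^ Fintype.card ι * Real.exp (-s + (j + 1 : ℕ) * (-1)) := by
        gcongr
        push_cast
        have h1 : s ≤ s * (j + 1) ^ 2 := le_mul_of_one_le_right hs (by nlinarith)
        have h2 : (n : ℝ) * (j + 1) ≤ n * (j + 1) ^ 2 := by
          refine mul_le_mul_of_nonneg_left ?_ (by positivity)
          nlinarith
        have h3 : (j : ℝ) + 1 ≤ n * (j + 1) := le_mul_of_one_le_left (by positivity) hn'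
        nlinarith
    _ ≤ _ := by
        rw [Real.exp_add, Real.exp_nat_mul]
        gcongr
        rw [Real.exp_neg, one_div]
        exact inv_anti₀ (by norm_num) (by linarith [Real.add_one_le_exp (1 : ℝ)])

open Classical in
-- If no link is large, the links sum to at most 3 · 4 = 12 units of C√T·R, where R = √(2(13n+s)),
-- and the end of the chain costs one more unit: hence 13. The exceptional sign patterns are summed
-- over the levels.
lemma card_sup_signSum_finset_le [Nonempty ι] (a : Φ → ι → ℝ) {n : ℕ}
    (hn : 1 ≤ n) (hdim : SubgraphDimLE a n) {C : ℝ} (hC : 0 < C) (ha : ∀ φ i, |a φ i| ≤ C)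
    (φ₀ : Φ) {s : ℝ} (hs : 0 ≤ s) (F : Finset Φ) :
    ((Finset.univ.filter fun σ : ι → Bool => ∃ φ ∈ F,
        13 * C * √(Fintype.card ι) * √(2 * (13 * n + s)) < signSum σ (a φ - a φ₀)).card : ℝ) ≤
      2 ^ Fintype.card ι * Real.exp (-s) := by
  obtain ⟨N, π, hπ0, hNπ⟩ := exists_euclDist_net_maps a hn hdim hC ha F φ₀
  have hT : (0 : ℝ) < Fintype.card ι := by exact_mod_cast Fintype.card_pos
  set R : ℝ := √(2 * (13 * n + s)) with hR
  have hn' : (1 : ℝ) ≤ n := by exact_mod_cast hn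
  have hR1 : 1 ≤ R := Real.one_le_sqrt.2 (by linarith)
  -- Depth at which Cauchy–Schwarz alone bounds the remainder by C√T for every sign pattern.
  obtain ⟨J, hJ⟩ := exists_pow_lt_of_lt_one (y := (1 / 2 : ℝ))
    (x := 1 / (2 * √(Fintype.card ι))) (by positivity) (by norm_num)
  set bad : ℕ → Finset (ι → Bool) := fun j => Finset.univ.filter fun σ : ι → Bool =>
      ∃ φ ∈ N (j + 1), ∃ ψ ∈ N j,
        euclDist (a φ) (a ψ) ≤ 3 * C * (1 / 2) ^ j * √(Fintype.card ι) ∧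
        3 * C * √(Fintype.card ι) * R * ((j + 1) * (1 / 2) ^ j) <
          signSum σ (a φ - a ψ) with hbad
  have hsub : (Finset.univ.filter fun σ : ι → Bool => ∃ φ ∈ F,
        13 * C * √(Fintype.card ι) * R < signSum σ (a φ - a φ₀)) ⊆
        (Finset.range J).biUnion bad := by
    intro σ hσ
    obtain ⟨-, φ, hφ, hlt⟩ := Finset.mem_filter.1 hσ
    by_contra hcon
    have hsmall : ∀ j ∈ Finset.range J, signSum σ (a (π (j + 1) φ) - a (π j φ)) ≤
        3 * C * √(Fintype.card ι) * R * ((j + 1) * (1 / 2) ^ j) := by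
      intro j hj
      by_contra! h
      refine hcon (Finset.mem_biUnion.2 ⟨j, hj, ?_⟩)
      simp only [hbad, Finset.mem_filter]
      refine ⟨Finset.mem_univ _, π (j + 1) φ, ((hNπ (j + 1)).2 φ hφ).1, π j φ,
        ((hNπ j).2 φ hφ).1, ?_, h⟩
      calc euclDist (a (π (j + 1) φ)) (a (π j φ))
          ≤ euclDist (a (π (j + 1) φ)) (a φ) + euclDist (a φ) (a (π j φ)) :=
            euclDist_triangle _ _ _
        _ ≤ 2 * C * (1 / 2) ^ (j + 1) * √(Fintype.card ι) +
            2 * C * (1 / 2) ^ j * √(Fintype.card ι) := by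
            rw [euclDist_comm (a (π (j + 1) φ))]
            exact add_le_add ((hNπ (j + 1)).2 φ hφ).2 ((hNπ j).2 φ hφ).2
        _ = _ := by rw [pow_succ]; ring
    have hlast : signSum σ (a φ - a (π J φ)) ≤ C * √(Fintype.card ι) * R := by
      calc signSum σ (a φ - a (π J φ)) ≤ ∑ i, |(a φ - a (π J φ)) i| :=
            (le_abs_self _).trans (abs_signSum_le _ _)
        _ ≤ √(Fintype.card ι) * euclDist (a φ) (a (π J φ)) := by
            rw [euclDist_eq]; exact sum_abs_le_sqrt_card_mul _
        _ ≤ √(Fintype.card ι) * (2 * C * (1 / 2) ^ J * √(Fintype.card ι)) := by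
            gcongr; exact ((hNπ J).2 φ hφ).2
        _ ≤ √(Fintype.card ι) * (2 * C * (1 / (2 * √(Fintype.card ι))) *
            √(Fintype.card ι)) := by gcongr
        _ = C * √(Fintype.card ι) * 1 := by field_simp
        _ ≤ _ := by gcongr
    have htel := signSum_telescope a (fun j => π j φ) σ J
    have hsum : signSum σ (a (π J φ) - a (π 0 φ)) ≤
        3 * C * √(Fintype.card ι) * R * 4 := by
      rw [htel]
      refine (Finset.sum_le_sum hsmall).trans ?_
      rw [← Finset.mul_sum]
      exact mul_le_mul_of_nonneg_left (sum_range_succ_mul_half_pow_le J) (by positivity)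
    rw [hπ0, signSum_sub] at hsum
    rw [signSum_sub] at hlast hlt
    linarith
  calc _ ≤ (((Finset.range J).biUnion bad).card : ℝ) := Nat.cast_le.2 (Finset.card_le_card hsub)
    _ ≤ ∑ j ∈ Finset.range J, ((bad j).card : ℝ) := by exact_mod_cast Finset.card_biUnion_le
    _ ≤ ∑ j ∈ Finset.range J, 2 ^ Fintype.card ι * (Real.exp (-s) * (1 / 2) ^ (j + 1)) :=
        Finset.sum_le_sum fun j _ => card_link_le a hn hC hs N (fun j => (hNπ j).1) j
    _ = 2 ^ Fintype.card ι * Real.exp (-s) * ∑ j ∈ Finset.range J, (1 / 2 : ℝ) ^ (j + 1) := by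
        rw [Finset.mul_sum]; exact Finset.sum_congr rfl fun _ _ => by ring
    _ ≤ _ := mul_le_of_le_one_right (by positivity) (sum_range_half_pow_succ_le J)

open Classical in
/-- Tail bound for the supremum of a Rademacher process over a class with small subgraph
dimension. -/
theorem card_sup_signSum_le [Nonempty ι] (a : Φ → ι → ℝ) {n : ℕ}
    (hn : 1 ≤ n) (hdim : SubgraphDimLE a n) {C : ℝ} (hC : 0 < C) (ha : ∀ φ i, |a φ i| ≤ C)
    (φ₀ : Φ) {s : ℝ} (hs : 0 ≤ s) :
    ((Finset.univ.filter fun σ : ι → Bool => ∃ φ,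
        13 * C * √(Fintype.card ι) * √(2 * (13 * n + s)) < signSum σ (a φ - a φ₀)).card : ℝ) ≤
      2 ^ Fintype.card ι * Real.exp (-s) := by
  -- There are finitely many sign patterns, so one witness for each reduces the supremum to a finite
  -- family.
  have h : ∀ σ : ι → Bool, ∃ φ, (∃ φ, 13 * C * √(Fintype.card ι) * √(2 * (13 * n + s)) <
      signSum σ (a φ - a φ₀)) → 13 * C * √(Fintype.card ι) * √(2 * (13 * n + s)) <
      signSum σ (a φ - a φ₀) := by
    intro σ
    by_cases h : ∃ φ, 13 * C * √(Fintype.card ι) * √(2 * (13 * n + s)) <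
      signSum σ (a φ - a φ₀)
    · exact ⟨h.choose, fun _ => h.choose_spec⟩
    · exact ⟨φ₀, fun h' => absurd h' h⟩
  choose c hc using h
  refine le_trans (Nat.cast_le.2 (Finset.card_le_card fun σ hσ => ?_))
    (card_sup_signSum_finset_le a hn hdim hC ha φ₀ hs (Finset.univ.image c))
  rw [Finset.mem_filter] at hσ ⊢
  exact ⟨hσ.1, c σ, Finset.mem_image_of_mem _ (Finset.mem_univ _), hc σ hσ.2⟩

end Rademacher

/-! ### Symmetrization for measurable selections -/

section Symmetrization

variable {Z Φ : Type*}

/-- Chebyshev's inequality for the lower tail of a sum of independent copies of `X`. -/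
lemma pi_sum_le_le [MeasurableSpace Z] (μ : Measure Z) [IsProbabilityMeasure μ] {X : Z → ℝ} (hX : Measurable X)
    {M : ℝ} (hM : ∀ᵐ z ∂μ, |X z| ≤ M) {T : ℕ} (hT : 0 < T) {c : ℝ} (hc : 0 < c) :
    (Measure.pi fun _ : Fin T => μ) {ω | ∑ t, X (ω t) ≤ T * (∫ z, X z ∂μ - c)} ≤
      ENNReal.ofReal (M ^ 2 / (T * c ^ 2)) := by
  have hT' : (0 : ℝ) < T := by exact_mod_cast hT
  have hLp : MemLp X 2 μ := MemLp.of_bound hX.aestronglyMeasurable M (by simpa using hM)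
  have hint : Integrable X μ := hLp.integrable (by norm_num)
  set Y : (Fin T → Z) → ℝ := ∑ t, fun ω => X (ω t) with hY
  have hLpt : ∀ t : Fin T, MemLp (fun ω : Fin T → Z => X (ω t)) 2 (Measure.pi fun _ => μ) :=
    fun t => hLp.comp_measurePreserving (measurePreserving_eval _ t)
  have hLpY : MemLp Y 2 (Measure.pi fun _ : Fin T => μ) := memLp_finsetSum' _ fun t _ => hLpt t
  have hYint : ∫ ω, Y ω ∂(Measure.pi fun _ : Fin T => μ) = T * ∫ z, X z ∂μ := by
    simp only [hY, Finset.sum_apply]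
    rw [integral_finsetSum _ fun t _ => (hLpt t).integrable (by norm_num)]
    have : ∀ t : Fin T, ∫ ω : Fin T → Z, X (ω t) ∂(Measure.pi fun _ => μ) = ∫ z, X z ∂μ :=
      fun t => integral_comp_eval (μ := fun _ : Fin T => μ) (i := t) hX.aestronglyMeasurable
    simp [this]
  have hvar : ProbabilityTheory.variance Y (Measure.pi fun _ : Fin T => μ) ≤ T * M ^ 2 := by
    rw [hY, ProbabilityTheory.variance_sum_pi (X := fun _ => X) fun _ => hLp, Finset.sum_const,
      Finset.card_univ, Fintype.card_fin, nsmul_eq_mul]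
    refine mul_le_mul_of_nonneg_left ?_ hT'.le
    refine (ProbabilityTheory.variance_le_expectation_sq hX.aestronglyMeasurable).trans ?_
    have hsq : ∀ᵐ z ∂μ, (X ^ 2) z ≤ M ^ 2 := by
      filter_upwards [hM] with z hz
      simpa using sq_le_sq' (by linarith [(abs_le.1 hz).1]) (abs_le.1 hz).2
    calc ∫ z, (X ^ 2) z ∂μ ≤ ∫ _, M ^ 2 ∂μ :=
          integral_mono_ae hLp.integrable_sq (integrable_const _) hsq
      _ = M ^ 2 := by simp
  have hcheb := ProbabilityTheory.meas_ge_le_variance_div_sq hLpY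
    (show 0 < (T : ℝ) * c by positivity)
  refine (measure_mono fun ω hω => ?_).trans (hcheb.trans (ENNReal.ofReal_le_ofReal ?_))
  · simp only [Set.mem_ofPred_eq] at hω ⊢
    rw [hYint, abs_sub_comm]
    refine le_trans ?_ (le_abs_self _)
    simp only [hY, Finset.sum_apply]
    linarith
  · calc _ ≤ T * M ^ 2 / (T * c) ^ 2 := by gcongr
      _ = _ := by field_simp

/-- Exchange the components of the `t`-th pair for which `σ t` is false. -/
def signSwap {T : ℕ} (σ : Fin T → Bool) (p : Fin T → Z × Z) : Fin T → Z × Z :=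
  fun t => if σ t then p t else (p t).swap

lemma measurePreserving_signSwap [MeasurableSpace Z] (μ : Measure Z) [IsProbabilityMeasure μ] {T : ℕ}
    (σ : Fin T → Bool) : MeasurePreserving (signSwap σ)
      (Measure.pi fun _ : Fin T => μ.prod μ) (Measure.pi fun _ : Fin T => μ.prod μ) := by
  refine measurePreserving_pi (fun _ : Fin T => μ.prod μ) (fun _ : Fin T => μ.prod μ)
    (f := fun t q => if σ t then q else q.swap) fun t => ?_
  by_cases h : σ t
  · simp only [h, if_true]
    exact MeasurePreserving.id _
  · simpa [h] using Measure.measurePreserving_swap (μ := μ) (ν := μ)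

open Classical in
/-- If each point lies in the images of an event under few sign swaps, the event has small
probability. -/
lemma measure_le_of_card_signSwap_le [MeasurableSpace Z] (μ : Measure Z) [IsProbabilityMeasure μ] {T : ℕ}
    {E : Set (Fin T → Z × Z)} (hE : MeasurableSet E) {c : ℝ}
    (h : ∀ᵐ p ∂(Measure.pi fun _ : Fin T => μ.prod μ),
      ((Finset.univ.filter fun σ : Fin T → Bool => signSwap σ p ∈ E).card : ℝ) ≤ 2 ^ T * c) :
    (Measure.pi fun _ : Fin T => μ.prod μ) E ≤ ENNReal.ofReal c := by
  set ν := Measure.pi fun _ : Fin T => μ.prod μ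
  -- Every swap preserves the measure, so ν E is the average over all swaps; exchanging sum and
  -- integral leaves a count of sign patterns at each point.
  have hswap : ∀ σ : Fin T → Bool, ν E = ∫⁻ p, (signSwap σ ⁻¹' E).indicator 1 p ∂ν := by
    intro σ
    rw [lintegral_indicator_one ((measurePreserving_signSwap μ σ).measurable hE),
      (measurePreserving_signSwap μ σ).measure_preimage hE.nullMeasurableSet]
  have h1 : (2 : ENNReal) ^ T * ν E ≤ 2 ^ T * ENNReal.ofReal c := by
    calc (2 : ENNReal) ^ T * ν E = ∑ _σ : Fin T → Bool, ν E := by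
          rw [Finset.sum_const, Finset.card_univ, nsmul_eq_mul]; simp
      _ = ∑ σ : Fin T → Bool, ∫⁻ p, (signSwap σ ⁻¹' E).indicator 1 p ∂ν :=
          Finset.sum_congr rfl fun σ _ => hswap σ
      _ = ∫⁻ p, ∑ σ : Fin T → Bool, (signSwap σ ⁻¹' E).indicator 1 p ∂ν := by
          rw [lintegral_finsetSum]
          intro σ _
          exact measurable_one.indicator ((measurePreserving_signSwap μ σ).measurable hE)
      _ ≤ ∫⁻ _, ENNReal.ofReal (2 ^ T * c) ∂ν := by
          refine lintegral_mono_ae ?_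
          filter_upwards [h] with p hp
          have : ∑ σ : Fin T → Bool, (signSwap σ ⁻¹' E).indicator (1 : (Fin T → Z × Z) → ENNReal) p =
              ENNReal.ofReal
                ((Finset.univ.filter fun σ : Fin T → Bool => signSwap σ p ∈ E).card : ℝ) := by
            rw [Finset.card_filter, ENNReal.ofReal_natCast, Nat.cast_sum]
            refine Finset.sum_congr rfl fun σ _ => ?_
            by_cases hσ : signSwap σ p ∈ E <;> simp [hσ]
          rw [this]
          exact ENNReal.ofReal_le_ofReal hp
      _ = 2 ^ T * ENNReal.ofReal c := by
          rw [lintegral_const, measure_univ, mul_one, ENNReal.ofReal_mul (by positivity)]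
          congr 1
          rw [ENNReal.ofReal_pow (by norm_num)]
          norm_num
  exact (ENNReal.mul_le_mul_iff_right (by simp) (by simp)).1 h1

lemma sum_signSwap_sub {T : ℕ} (σ : Fin T → Bool) (p : Fin T → Z × Z) (X : Z → ℝ) :
    ∑ t, X (signSwap σ p t).2 - ∑ t, X (signSwap σ p t).1 =
      signSum σ (fun t => X (p t).2) - signSum σ (fun t => X (p t).1) := by
  rw [signSum, signSum, ← Finset.sum_sub_distrib, ← Finset.sum_sub_distrib]
  refine Finset.sum_congr rfl fun t _ => ?_
  cases h : σ t <;> simp [signSwap, h]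
  ring

open Classical in
-- One of the two processes must exceed half the level. Treating the two halves of the double sample
-- separately avoids the dimension of a class of differences; the minus sign is removed by flipping
-- all signs, a bijection of the patterns.
lemma card_sup_signSum_sub_le {T : ℕ} (hT : 0 < T) (a b : Φ → Fin T → ℝ) {n : ℕ} (hn : 1 ≤ n)
    (ha : SubgraphDimLE a n) (hb : SubgraphDimLE b n) {C : ℝ} (hC : 0 < C)
    (haC : ∀ φ i, |a φ i| ≤ C) (hbC : ∀ φ i, |b φ i| ≤ C) (φ₀ : Φ) {s : ℝ} (hs : 0 ≤ s) {u : ℝ}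
    (hu : 13 * C * √T * √(2 * (13 * n + s)) ≤ u) :
    ((Finset.univ.filter fun σ : Fin T → Bool => ∃ φ,
        2 * u < signSum σ (b φ - b φ₀) - signSum σ (a φ - a φ₀)).card : ℝ) ≤
      2 ^ T * (2 * Real.exp (-s)) := by
  have : Nonempty (Fin T) := ⟨⟨0, hT⟩⟩
  have h1 := card_sup_signSum_le a hn ha hC haC φ₀ hs
  have h2 := card_sup_signSum_le b hn hb hC hbC φ₀ hs
  rw [Fintype.card_fin] at h1 h2
  set v := 13 * C * √T * √(2 * (13 * n + s))
  set A := Finset.univ.filter fun σ : Fin T → Bool => ∃ φ, v < signSum σ (a φ - a φ₀) with hA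
  set A' := Finset.univ.filter fun σ : Fin T → Bool =>
    ∃ φ, v < signSum (fun i => !σ i) (a φ - a φ₀) with hA'
  set B := Finset.univ.filter fun σ : Fin T → Bool => ∃ φ, v < signSum σ (b φ - b φ₀) with hB
  have hAA' : A'.card ≤ A.card := by
    refine Finset.card_le_card_of_injOn (fun σ i => !σ i) ?_ ?_
    · intro σ hσ
      simp only [hA', hA, Finset.coe_filter, Set.mem_ofPred_eq] at hσ ⊢
      exact ⟨Finset.mem_univ _, hσ.2⟩
    · intro σ _ τ _ h
      funext i
      simpa using congrFun h i
  have hsub : (Finset.univ.filter fun σ : Fin T → Bool => ∃ φ,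
        2 * u < signSum σ (b φ - b φ₀) - signSum σ (a φ - a φ₀)) ⊆ B ∪ A' := by
    intro σ hσ
    obtain ⟨-, φ, hφ⟩ := Finset.mem_filter.1 hσ
    rw [Finset.mem_union, hB, hA', Finset.mem_filter, Finset.mem_filter]
    by_cases h : v < signSum σ (b φ - b φ₀)
    · exact Or.inl ⟨Finset.mem_univ _, φ, h⟩
    · refine Or.inr ⟨Finset.mem_univ _, φ, ?_⟩
      rw [signSum_not]
      linarith
  have h3 := (Finset.card_le_card hsub).trans (Finset.card_union_le _ _)
  have h4 : ((Finset.univ.filter fun σ : Fin T → Bool => ∃ φ,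
        2 * u < signSum σ (b φ - b φ₀) - signSum σ (a φ - a φ₀)).card : ℝ) ≤
        B.card + A.card := by exact_mod_cast h3.trans (by omega)
  have h5 : (A.card : ℝ) ≤ 2 ^ T * Real.exp (-s) := by convert h1
  have h6 : (B.card : ℝ) ≤ 2 ^ T * Real.exp (-s) := by convert h2
  linarith

variable [MeasurableSpace Φ]

/-- The ghost-sample inequality for a measurable selection `ψ`: if the mean of `g (ψ ω)` exceeds
`ε` while its sum over the sample `ω` is not positive, then with probability at least `1 / 2` its
sum over an independent sample is larger than over `ω`. -/
lemma measure_selection_le_two_mul_ghost [MeasurableSpace Z] (μ : Measure Z) [IsProbabilityMeasure μ]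
    {g : Φ → Z → ℝ} (hg : Measurable (Function.uncurry g)) {M : ℝ}
    (hM : ∀ φ, ∀ᵐ z ∂μ, |g φ z| ≤ M) {T : ℕ} (hT : 0 < T) {ε : ℝ} (hε : 0 < ε)
    (hTM : 8 * M ^ 2 ≤ T * ε ^ 2) {ψ : (Fin T → Z) → Φ} (hψ : Measurable ψ)
    (hERM : ∀ᵐ ω ∂(Measure.pi fun _ : Fin T => μ), ∑ t, g (ψ ω) (ω t) ≤ 0) :
    (Measure.pi fun _ : Fin T => μ) {ω | ε < ∫ z, g (ψ ω) z ∂μ} ≤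
      2 * (Measure.pi fun _ : Fin T => μ.prod μ)
        {p | T * (ε / 2) < ∑ t, g (ψ fun t => (p t).1) (p t).2 -
          ∑ t, g (ψ fun t => (p t).1) (p t).1} := by
  have hT' : (0 : ℝ) < T := by exact_mod_cast hT
  set ν := Measure.pi fun _ : Fin T => μ
  set G : Set (Fin T → Z) := {ω | ε < ∫ z, g (ψ ω) z ∂μ} with hG
  set E : Set ((Fin T → Z) × (Fin T → Z)) :=
    {q | T * (ε / 2) < ∑ t, g (ψ q.1) (q.2 t) - ∑ t, g (ψ q.1) (q.1 t)} with hE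
  have hGmeas : MeasurableSet G := by
    refine measurableSet_lt measurable_const ?_
    have : StronglyMeasurable fun q : (Fin T → Z) × Z => g (ψ q.1) q.2 :=
      (hg.comp ((hψ.comp measurable_fst).prodMk measurable_snd)).stronglyMeasurable
    exact this.integral_prod_right.measurable
  have hEmeas : MeasurableSet E := by
    refine measurableSet_lt measurable_const (Measurable.sub ?_ ?_)
    · refine Finset.measurable_sum _ fun t _ => ?_
      exact hg.comp ((hψ.comp measurable_fst).prodMk
        ((measurable_pi_apply t).comp measurable_snd))
    · refine Finset.measurable_sum _ fun t _ => ?_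
      exact hg.comp ((hψ.comp measurable_fst).prodMk
        ((measurable_pi_apply t).comp measurable_fst))
  have hpres := measurePreserving_arrowProdEquivProdArrow Z Z (Fin T) (fun _ => μ) fun _ => μ
  have hEeq : (Measure.pi fun _ : Fin T => μ.prod μ)
        {p | T * (ε / 2) < ∑ t, g (ψ fun t => (p t).1) (p t).2 -
          ∑ t, g (ψ fun t => (p t).1) (p t).1} = (ν.prod ν) E := by
    rw [← hpres.measure_preimage hEmeas.nullMeasurableSet]
    rfl
  -- For fixed ω the selected function is fixed, so Chebyshev applies to the independent second
  -- sample; `hTM` makes its failure probability 4M² / (Tε²) at most 1 / 2.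
  have hsec : ∀ᵐ ω ∂ν, G.indicator (fun _ => (2 : ENNReal)⁻¹) ω ≤ ν (Prod.mk ω ⁻¹' E) := by
    filter_upwards [hERM] with ω hω
    by_cases hωG : ω ∈ G
    · rw [Set.indicator_of_mem hωG]
      have hX : Measurable (g (ψ ω)) := hg.comp measurable_prodMk_left
      have hcheb := pi_sum_le_le μ hX (hM (ψ ω)) hT (half_pos hε)
      set Bad : Set (Fin T → Z) := {ω' | ∑ t, g (ψ ω) (ω' t) ≤
        T * (∫ z, g (ψ ω) z ∂μ - ε / 2)} with hBad
      have hBadmeas : MeasurableSet Bad :=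
        measurableSet_le (Finset.measurable_sum _ fun t _ => hX.comp (measurable_pi_apply t))
          measurable_const
      have hBad2 : ν Bad ≤ 2⁻¹ := by
        refine hcheb.trans ?_
        rw [show (2 : ENNReal)⁻¹ = ENNReal.ofReal 2⁻¹ by
          rw [ENNReal.ofReal_inv_of_pos (by norm_num)]; norm_num]
        refine ENNReal.ofReal_le_ofReal ?_
        rw [div_le_iff₀ (by positivity)]
        nlinarith
      have hcompl : Badᶜ ⊆ Prod.mk ω ⁻¹' E := by
        intro ω' hω'
        simp only [hBad, Set.mem_compl_iff, Set.mem_ofPred_eq, not_le] at hω'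
        simp only [hE, Set.mem_preimage, Set.mem_ofPred_eq]
        have h1 : T * (ε / 2) < T * (∫ z, g (ψ ω) z ∂μ - ε / 2) := by
          refine mul_lt_mul_of_pos_left ?_ hT'
          have : ε < ∫ z, g (ψ ω) z ∂μ := hωG
          linarith
        linarith
      refine le_trans ?_ (measure_mono hcompl)
      rw [measure_compl hBadmeas (measure_ne_top _ _), measure_univ]
      refine le_trans ?_ (tsub_le_tsub_left hBad2 1)
      rw [ENNReal.one_sub_inv_two]
    · rw [Set.indicator_of_notMem hωG]
      exact zero_le
  rw [hEeq, Measure.prod_apply hEmeas]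
  calc ν G = 2 * (2⁻¹ * ν G) := by
        rw [← mul_assoc, ENNReal.mul_inv_cancel (by norm_num) (by norm_num), one_mul]
    _ = 2 * ∫⁻ ω, G.indicator (fun _ => (2 : ENNReal)⁻¹) ω ∂ν := by
        rw [lintegral_indicator_const hGmeas]
    _ ≤ _ := by gcongr 2 * ?_; exact lintegral_mono_ae hsec

/-- Excess risk of empirical risk minimization over a class whose subgraphs have dimension at most
`n`, without logarithmic loss in the sample size. -/
theorem measure_excess_risk_gt_le [MeasurableSpace Z] (μ : Measure Z) [IsProbabilityMeasure μ]
    {g : Φ → Z → ℝ} (hg : Measurable (Function.uncurry g)) {A : Set Z} (hA : ∀ᵐ z ∂μ, z ∈ A)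
    {C : ℝ} (hC : 0 < C) (hgC : ∀ φ, ∀ z ∈ A, |g φ z| ≤ C) {n : ℕ} (hn : 1 ≤ n) {T : ℕ}
    (hdim : ∀ z : Fin T → Z, (∀ t, z t ∈ A) → SubgraphDimLE (fun φ t => g φ (z t)) n)
    {ε δ : ℝ} (hε : 0 < ε) (hδ : 0 < δ) (hδ1 : δ < 1)
    (hTn : 100000 * C ^ 2 * (n + Real.log (1 / δ)) ≤ T * ε ^ 2)
    (φ₀ : Φ) {ψ : (Fin T → Z) → Φ} (hψ : Measurable ψ)
    (hERM : ∀ᵐ ω ∂(Measure.pi fun _ : Fin T => μ),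
      ∑ t, g (ψ ω) (ω t) ≤ ∑ t, g φ₀ (ω t)) :
    (Measure.pi fun _ : Fin T => μ) {ω | ε < ∫ z, g (ψ ω) z ∂μ - ∫ z, g φ₀ z ∂μ} ≤
      ENNReal.ofReal δ := by
  classical
  have hn' : (1 : ℝ) ≤ n := by exact_mod_cast hn
  have hlog : 0 ≤ Real.log (1 / δ) := Real.log_nonneg (by rw [le_div_iff₀ hδ]; linarith)
  have hC2 : 0 < C ^ 2 := by positivity
  have hTpos : 0 < T := by
    rcases Nat.eq_zero_or_pos T with h | h
    · rw [h] at hTn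
      have : 0 < 100000 * C ^ 2 * (n + Real.log (1 / δ)) := by positivity
      rw [Nat.cast_zero, zero_mul] at hTn
      linarith
    · exact h
  have hT' : (0 : ℝ) < T := by exact_mod_cast hTpos
  -- Centering at φ₀ turns empirical minimality into a nonpositive empirical sum, at the price of
  -- the bound 2C.
  set g' : Φ → Z → ℝ := fun φ z => g φ z - g φ₀ z with hg'
  have hgφ : ∀ φ, Measurable (g φ) := fun φ => hg.comp measurable_prodMk_left
  have hg'meas : Measurable (Function.uncurry g') := by
    have h2 : Measurable fun q : Φ × Z => g φ₀ q.2 := (hgφ φ₀).comp measurable_snd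
    exact hg.sub h2
  have hg'M : ∀ φ, ∀ᵐ z ∂μ, |g' φ z| ≤ 2 * C := fun φ => by
    filter_upwards [hA] with z hz
    have := abs_sub (g φ z) (g φ₀ z)
    linarith [hgC φ z hz, hgC φ₀ z hz]
  have hint : ∀ φ, Integrable (g φ) μ := fun φ => by
    refine Integrable.of_bound (hgφ φ).aestronglyMeasurable C ?_
    filter_upwards [hA] with z hz using hgC φ z hz
  have hghost := measure_selection_le_two_mul_ghost μ hg'meas hg'M hTpos hε
    (by nlinarith [mul_nonneg hC2.le hlog, mul_le_mul_of_nonneg_left hn' hC2.le]) hψ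
    (by
      filter_upwards [hERM] with ω hω
      simp only [hg', Finset.sum_sub_distrib]
      linarith)
  -- The 4 cancels two factors 2, one from the ghost sample and one from the two sign processes.
  set s : ℝ := Real.log (4 / δ) with hs
  have hs_eq : s = 2 * Real.log 2 + Real.log (1 / δ) := by
    rw [hs, show (4 : ℝ) / δ = 2 ^ 2 * (1 / δ) by ring, Real.log_mul (by norm_num) (by positivity),
      Real.log_pow]
    norm_num
  have hl2 := Real.log_two_lt_d9
  have hl2' := Real.log_two_gt_d9
  have hs0 : 0 ≤ s := by rw [hs_eq]; linarith
  have hexp : Real.exp (-s) = δ / 4 := by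
    rw [hs, Real.exp_neg, Real.exp_log (by positivity), inv_div]
  -- Source of the constant: 16 · 169 · 2 = 5408 and s ≤ 2n + log(1/δ), so 5408 · 15 = 81120 <
  -- 100000 suffices.
  have hu : 13 * C * √T * √(2 * (13 * n + s)) ≤ T * (ε / 4) := by
    refine le_of_sq_le_sq ?_ (by positivity)
    have h1 : √(T : ℝ) ^ 2 = T := Real.sq_sqrt hT'.le
    have h2 : √(2 * (13 * n + s)) ^ 2 = 2 * (13 * n + s) := Real.sq_sqrt (by positivity)
    calc (13 * C * √T * √(2 * (13 * n + s))) ^ 2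
        = T * (169 * C ^ 2 * (2 * (13 * n + s))) := by simp only [mul_pow, h1, h2]; ring
      _ ≤ T * (T * ε ^ 2 / 16) := by
          refine mul_le_mul_of_nonneg_left ?_ hT'.le
          have h3 : C ^ 2 * s ≤ C ^ 2 * (2 * n + Real.log (1 / δ)) :=
            mul_le_mul_of_nonneg_left (by rw [hs_eq]; linarith) hC2.le
          nlinarith [mul_nonneg hC2.le hlog, mul_le_mul_of_nonneg_left hn' hC2.le]
      _ = _ := by ring
  have hEmeas : MeasurableSet {p : Fin T → Z × Z | T * (ε / 2) <
      ∑ t, g' (ψ fun t => (p t).1) (p t).2 - ∑ t, g' (ψ fun t => (p t).1) (p t).1} := by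
    have hψ' : Measurable fun p : Fin T → Z × Z => ψ fun t => (p t).1 :=
      hψ.comp (measurable_pi_lambda _ fun t => measurable_fst.comp (measurable_pi_apply t))
    refine measurableSet_lt measurable_const (Measurable.sub ?_ ?_)
    · exact Finset.measurable_sum _ fun t _ =>
        hg'meas.comp (hψ'.prodMk (measurable_snd.comp (measurable_pi_apply t)))
    · exact Finset.measurable_sum _ fun t _ =>
        hg'meas.comp (hψ'.prodMk (measurable_fst.comp (measurable_pi_apply t)))
  have hsym := measure_le_of_card_signSwap_le μ hEmeas (c := 2 * Real.exp (-s)) (by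
    have hA1 : ∀ᵐ q ∂(μ.prod μ), q.1 ∈ A ∧ q.2 ∈ A :=
      (Measure.quasiMeasurePreserving_fst.ae hA).and (Measure.quasiMeasurePreserving_snd.ae hA)
    have hA2 : ∀ᵐ p ∂(Measure.pi fun _ : Fin T => μ.prod μ), ∀ t, (p t).1 ∈ A ∧ (p t).2 ∈ A :=
      ae_all_iff.2 fun t =>
        (measurePreserving_eval (fun _ : Fin T => μ.prod μ) t).quasiMeasurePreserving.ae hA1
    filter_upwards [hA2] with p hp
    refine le_trans (Nat.cast_le.2 (Finset.card_le_card fun σ hσ => ?_))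
      (card_sup_signSum_sub_le hTpos (fun φ t => g φ (p t).1) (fun φ t => g φ (p t).2) hn
        (hdim _ fun t => (hp t).1) (hdim _ fun t => (hp t).2) hC
        (fun φ t => hgC φ _ (hp t).1) (fun φ t => hgC φ _ (hp t).2) φ₀ hs0 hu)
    rw [Finset.mem_filter] at hσ ⊢
    -- The selection depends on the signs through the swapped sample, which is why a bound uniform
    -- in φ is needed here.
    refine ⟨Finset.mem_univ _, ψ fun t => (signSwap σ p t).1, ?_⟩
    have := hσ.2
    rw [sum_signSwap_sub σ p (g' (ψ fun t => (signSwap σ p t).1))] at this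
    calc _ = T * (ε / 2) := by ring
      _ < _ := this)
  have hset : {ω | ε < ∫ z, g (ψ ω) z ∂μ - ∫ z, g φ₀ z ∂μ} =
      {ω : Fin T → Z | ε < ∫ z, g' (ψ ω) z ∂μ} := by
    ext ω
    simp only [Set.mem_ofPred_eq, hg']
    rw [integral_sub (hint _) (hint _)]
  rw [hset]
  calc _ ≤ _ := hghost
    _ ≤ 2 * ENNReal.ofReal (2 * Real.exp (-s)) := by gcongr
    _ = ENNReal.ofReal δ := by
      rw [hexp, show (2 : ENNReal) = ENNReal.ofReal 2 by norm_num,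
        ← ENNReal.ofReal_mul (by norm_num)]
      congr 1
      ring

end Symmetrization

/-! ### Measurability of the validation loss -/

section Measurability

open Filter Topology

/-- Failed runs get the default value 0, and division fails exactly on the measurable set {v = 0}.
The rest of the run is a continuation `k`, as the induction over algorithms requires. -/
lemma GJOp.run_getD_bind_measurable {Ω : Type*} [MeasurableSpace Ω] (op : GJOp)
    {u v : Ω → ℝ} (hu : Measurable u) (hv : Measurable v) {k : Ω → ℝ → Option ℝ}
    (hk : ∀ a : Ω → ℝ, Measurable a → Measurable fun ω => (k ω (a ω)).getD 0) :
    Measurable fun ω => ((op.run (u ω) (v ω)).bind (k ω)).getD 0 := by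
  cases op with
  | add => exact hk _ (hu.add hv)
  | sub => exact hk _ (hu.sub hv)
  | mul => exact hk _ (hu.mul hv)
  | div =>
    have : (fun ω => ((GJOp.div.run (u ω) (v ω)).bind (k ω)).getD 0) =
        fun ω => if v ω = 0 then 0 else (k ω (u ω / v ω)).getD 0 := by
      funext ω
      by_cases h : v ω = 0 <;> simp [GJOp.run, h]
    rw [this]
    exact Measurable.ite (hv (measurableSet_singleton 0)) measurable_const (hk _ (hu.div hv))

lemma GJAlgorithm.measurable_run_getD {ι : Type} {Ω : Type*} [MeasurableSpace Ω] {x : Ω → ι → ℝ}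
    (hx : Measurable x) {k : ℕ} (A : GJAlgorithm ι k) :
    ∀ {vals : Ω → Fin k → ℝ}, Measurable vals →
      Measurable fun ω => (A.run (x ω) (vals ω)).getD 0 := by
  have hop : ∀ {k : ℕ} {vals : Ω → Fin k → ℝ}, Measurable vals → ∀ u : ι ⊕ Fin k,
      Measurable fun ω => Sum.elim (x ω) (vals ω) u := by
    intro k vals hvals u
    rcases u with i | i
    · exact (measurable_pi_apply i).comp hx
    · exact (measurable_pi_apply i).comp hvals
  have hsnoc : ∀ {k : ℕ} {vals : Ω → Fin k → ℝ} {c : Ω → ℝ}, Measurable vals → Measurable c →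
      Measurable fun ω => (Fin.snoc (vals ω) (c ω) : Fin (k + 1) → ℝ) := by
    intro k vals c hvals hc
    refine measurable_pi_lambda _ fun i => ?_
    refine Fin.lastCases ?_ (fun i => ?_) i
    · simpa using hc
    · simp only [Fin.snoc_castSucc]
      exact (measurable_pi_apply i).comp hvals
  induction A with
  | ret u =>
    intro vals hvals
    exact hop hvals u
  | const c next ih =>
    intro vals hvals
    exact ih (hsnoc hvals measurable_const)
  | arith op u v next ih =>
    intro vals hvals
    exact op.run_getD_bind_measurable (hop hvals u) (hop hvals v) fun a ha => ih (hsnoc hvals ha)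
  | cond u yes no ih1 ih2 =>
    intro vals hvals
    have : (fun ω => ((GJAlgorithm.cond u yes no).run (x ω) (vals ω)).getD 0) =
        fun ω => if 0 ≤ Sum.elim (x ω) (vals ω) u then (yes.run (x ω) (vals ω)).getD 0
          else (no.run (x ω) (vals ω)).getD 0 := by
      funext ω
      by_cases h : 0 ≤ Sum.elim (x ω) (vals ω) u <;> simp [GJAlgorithm.run, h]
    rw [this]
    exact Measurable.ite (measurableSet_le measurable_const (hop hvals u)) (ih1 hvals) (ih2 hvals)

lemma GJComputable.measurable {ι : Type} {Δ Λ : ℕ} {g : (ι → ℝ) → ℝ}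
    (hg : GJComputable Δ Λ g) : Measurable g := by
  obtain ⟨A, -, -, hA⟩ := hg
  have h := A.measurable_run_getD (x := fun x : ι → ℝ => x) measurable_id
    (vals := fun _ => Fin.elim0) measurable_const
  simpa [hA] using h

/-- A directional derivative of a jointly measurable function is jointly measurable. -/
lemma measurable_fderiv_apply_param {Ω E : Type*} [MeasurableSpace Ω] [NormedAddCommGroup E]
    [NormedSpace ℝ E] [MeasurableSpace E] [BorelSpace E] [SecondCountableTopology E]
    {g : Ω → E → ℝ} (hg : Measurable (Function.uncurry g)) (hd : ∀ x, Differentiable ℝ (g x))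
    (e : E) : Measurable fun q : Ω × E => fderiv ℝ (g q.1) q.2 e := by
  -- Difference quotients with step 1 / (n + 1) are jointly measurable and converge pointwise, so no
  -- continuity in the parameter is involved.
  have hlim : ∀ q : Ω × E, Tendsto (fun n : ℕ => ((n : ℝ) + 1) *
      (g q.1 (q.2 + ((n : ℝ) + 1)⁻¹ • e) - g q.1 q.2)) atTop (𝓝 (fderiv ℝ (g q.1) q.2 e)) := by
    intro q
    have h := (hd q.1 q.2).hasFDerivAt.lim_real e
    have hn : Tendsto (fun n : ℕ => (n : ℝ) + 1) atTop atTop :=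
      tendsto_atTop_add_const_right _ _ tendsto_natCast_atTop_atTop
    exact h.comp hn
  refine measurable_of_tendsto_metrizable (fun n => ?_) (tendsto_pi_nhds.2 hlim)
  refine measurable_const.mul (Measurable.sub ?_ hg)
  exact hg.comp (measurable_fst.prodMk (measurable_snd.add measurable_const))

variable {dx d h n nv : ℕ} {f : Vec dx → Vec d → ℝ} {l : ℝ → ℝ → ℝ} {r : Vec d → Vec h → Vec d}

lemma measurable_lgdGradient (hf : Measurable (Function.uncurry f))
    (hl : Measurable (Function.uncurry l)) (hr : Measurable (Function.uncurry r))
    (hfd : ∀ x, Differentiable ℝ (f x)) (hld : ∀ y, Differentiable ℝ (l y)) {Ω : Type*}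
    [MeasurableSpace Ω] {X : Ω → Fin n → Vec dx} {y : Ω → Fin n → ℝ} {θ : Ω → Vec h}
    {w : Ω → Vec d} (hX : Measurable X) (hy : Measurable y) (hθ : Measurable θ)
    (hw : Measurable w) :
    Measurable fun ω => lgdGradient f l r (X ω) (y ω) (θ ω) (w ω) := by
  have hderiv : Measurable fun q : ℝ × ℝ => deriv (l q.1) q.2 := by
    simpa only [fderiv_apply_one_eq_deriv] using measurable_fderiv_apply_param hl hld (1 : ℝ)
  have hgrad : Measurable fun q : Vec dx × Vec d => gradient (f q.1) q.2 := by
    have : Measurable fun q : Vec dx × Vec d => fun j => gradient (f q.1) q.2 j := by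
      refine measurable_pi_lambda _ fun j => ?_
      convert measurable_fderiv_apply_param hf hfd (EuclideanSpace.single j (1 : ℝ)) using 2 with q
      rw [gradient, ← InnerProductSpace.toDual_symm_apply, EuclideanSpace.inner_single_right]
      simp
    exact (WithLp.measurable_toLp 2 _).comp this
  have hXi : ∀ i, Measurable fun ω => X ω i := fun i => (measurable_pi_apply i).comp hX
  have hyi : ∀ i, Measurable fun ω => y ω i := fun i => (measurable_pi_apply i).comp hy
  unfold lgdGradient
  refine Measurable.add (Finset.measurable_sum _ fun i _ => Measurable.fun_smul ?_ ?_) ?_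
  · exact hderiv.comp ((hyi i).prodMk (hf.comp ((hXi i).prodMk hw)))
  · exact hgrad.comp ((hXi i).prodMk hw)
  · exact hr.comp (hw.prodMk hθ)

lemma measurable_lgdIterate (hf : Measurable (Function.uncurry f))
    (hl : Measurable (Function.uncurry l)) (hr : Measurable (Function.uncurry r))
    (hfd : ∀ x, Differentiable ℝ (f x)) (hld : ∀ y, Differentiable ℝ (l y)) {Ω : Type*}
    [MeasurableSpace Ω] {N : ℕ} {φ : Ω → Hyperparam h} {ξ : Ω → LangevinNoise N d}
    {X : Ω → Fin n → Vec dx} {y : Ω → Fin n → ℝ} (hφ : Measurable φ) (hξ : Measurable ξ)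
    (hX : Measurable X) (hy : Measurable y) (k : ℕ) :
    Measurable fun ω => lgdIterate f l r (φ ω) (ξ ω) (X ω) (y ω) k := by
  have hη : Measurable fun ω => learningRate (φ ω) :=
    (measurable_subtype_coe.comp (measurable_snd.comp hφ)).pow_const 2
  induction k with
  | zero => exact measurable_const
  | succ k ih =>
    simp only [lgdIterate]
    by_cases hk : k < N
    · simp only [hk, dif_pos]
      refine (ih.sub (hη.smul ?_)).add (Measurable.fun_smul ?_ ?_)
      · exact measurable_lgdGradient hf hl hr hfd hld hX hy (measurable_fst.comp hφ) ih
      · exact (measurable_const.mul hη).sqrt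
      · exact (measurable_pi_apply _).comp hξ
    · simpa only [hk, dif_neg, not_false_eq_true] using ih

lemma measurable_validationLoss (hf : Measurable (Function.uncurry f))
    (hl : Measurable (Function.uncurry l)) (hr : Measurable (Function.uncurry r))
    (hfd : ∀ x, Differentiable ℝ (f x)) (hld : ∀ y, Differentiable ℝ (l y)) (B b : ℕ) :
    Measurable fun q : Hyperparam h × (LangevinNoise (B + b) d × RegTask dx n nv) =>
      validationLoss f l r B b q.1 q.2.1 q.2.2 := by
  unfold validationLoss lgdPredict
  refine measurable_const.mul (Finset.measurable_sum _ fun i _ => ?_)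
  have hyv : Measurable fun q : Hyperparam h × (LangevinNoise (B + b) d × RegTask dx n nv) =>
      q.2.2.2.2.2 i := by fun_prop
  have hxv : Measurable fun q : Hyperparam h × (LangevinNoise (B + b) d × RegTask dx n nv) =>
      q.2.2.2.2.1 i := by fun_prop
  refine hl.comp (hyv.prodMk (measurable_const.mul (Finset.measurable_sum _ fun k _ => ?_)))
  refine hf.comp (hxv.prodMk ?_)
  exact measurable_lgdIterate hf hl hr hfd hld (by fun_prop) (by fun_prop) (by fun_prop)
    (by fun_prop) k

end Measurability

/-! ### Pseudo-dimension and the generalization bound -/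

section PseudoDimension

/-- Two distinct pairs over the same point cannot both lie in S: cutting out only the one with the
larger threshold would force the smaller one in as well. So thresholds are a function of the point,
even when the sample repeats points, and S yields a pseudo-shattered set of equal size. -/
lemma subgraphDimLE_of_pdim_le {Z Φ ι : Type*} {G : Set (Z → ℝ)} {n : ℕ} (hG : pdim G ≤ n)
    (a : Φ → ι → ℝ) (z : ι → Z) (ha : ∀ φ, ∃ g ∈ G, ∀ i, a φ i = g (z i)) :
    SubgraphDimLE a n := by
  classical
  intro S hS
  have hle : ∀ p ∈ S, ∀ q ∈ S, z p.1 = z q.1 → p.2 ≤ q.2 → p = q := by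
    intro p hp q hq hpq hle
    obtain ⟨φ, hφ⟩ := hS {q} (Finset.singleton_subset_iff.2 hq)
    obtain ⟨g, -, hg⟩ := ha φ
    have h1 := (hφ q hq).2 (Finset.mem_singleton_self q)
    refine Finset.mem_singleton.1 ((hφ p hp).1 (hle.trans ?_))
    rwa [hg, hpq, ← hg]
  have hinj : Set.InjOn (fun p : ι × ℝ => z p.1) S := by
    intro p hp q hq hpq
    rcases le_total p.2 q.2 with h | h
    · exact hle p hp q hq hpq h
    · exact (hle q hq p hp hpq.symm h).symm
  rcases S.eq_empty_or_nonempty with rfl | ⟨p₀, -⟩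
  · simp
  have : Nonempty (ι × ℝ) := ⟨p₀⟩
  set τ : Z → ℝ := fun x => (Function.invFunOn (fun p : ι × ℝ => z p.1) S x).2
  have hτ : ∀ p ∈ S, τ (z p.1) = p.2 := fun p hp =>
    congrArg Prod.snd (hinj.leftInvOn_invFunOn hp)
  have hsh : PseudoShattered G (S.image fun p => z p.1) := by
    refine ⟨τ, fun U _ => ?_⟩
    obtain ⟨φ, hφ⟩ := hS (S.filter fun p => z p.1 ∈ U) (Finset.filter_subset _ _)
    obtain ⟨g, hg, hag⟩ := ha φ
    refine ⟨g, hg, fun x hx => ?_⟩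
    obtain ⟨p, hp, rfl⟩ := Finset.mem_image.1 hx
    rw [hτ p hp, ← hag, hφ p hp, Finset.mem_filter]
    exact and_iff_right hp
  have h1 : ((S.image fun p => z p.1).card : ℕ∞) ≤ pdim G :=
    le_iSup₂ (f := fun (S : Finset Z) (_ : PseudoShattered G S) => (S.card : ℕ∞)) _ hsh
  rw [Finset.card_image_of_injOn hinj] at h1
  exact_mod_cast h1.trans hG

/-- Otherwise the threshold g z would shatter {z}. This settles dimension 0, which the packing bound
excludes. -/
lemma le_of_pdim_eq_zero {Z : Type*} {G : Set (Z → ℝ)} (hG : pdim G = 0) {g g' : Z → ℝ}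
    (hg : g ∈ G) (hg' : g' ∈ G) (z : Z) : g z ≤ g' z := by
  by_contra! h
  have hsh : PseudoShattered G {z} := by
    refine ⟨g, fun U hU => ?_⟩
    by_cases hz : z ∈ U
    · exact ⟨g, hg, by simp [hz]⟩
    · exact ⟨g', hg', by simp [hz, h]⟩
  have h1 : ((Finset.card {z} : ℕ) : ℕ∞) ≤ pdim G :=
    le_iSup₂ (f := fun (S : Finset Z) (_ : PseudoShattered G S) => (S.card : ℕ∞)) _ hsh
  rw [hG] at h1
  simp at h1

lemma measurable_uncurry_of_euclidean {κ κ' β : Type*} [Fintype κ] [Fintype κ']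
    [MeasurableSpace β] {F : EuclideanSpace ℝ κ → EuclideanSpace ℝ κ' → β}
    (hF : Measurable fun v : κ ⊕ κ' → ℝ =>
      F (WithLp.toLp 2 fun i => v (Sum.inl i)) (WithLp.toLp 2 fun j => v (Sum.inr j))) :
    Measurable (Function.uncurry F) := by
  have hmap : Measurable fun q : EuclideanSpace ℝ κ × EuclideanSpace ℝ κ' =>
      (Sum.elim (fun i => q.1 i) (fun j => q.2 j) : κ ⊕ κ' → ℝ) := by
    refine measurable_pi_lambda _ fun i => ?_
    rcases i with i | i
    · simp only [Sum.elim_inl]; fun_prop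
    · simp only [Sum.elim_inr]; fun_prop
  exact hF.comp hmap

end PseudoDimension

lemma abs_validationLoss_le {dx d h n nv : ℕ} (hnv : 0 < nv) {f : Vec dx → Vec d → ℝ}
    {l : ℝ → ℝ → ℝ} {r : Vec d → Vec h → Vec d} {B b : ℕ} {φ : Hyperparam h}
    {ξ : LangevinNoise (B + b) d} {P : RegTask dx n nv} {C : ℝ}
    (hC : ∀ i : Fin nv,
      |l (P.2.2.2 i) (lgdPredict f l r B b φ ξ P.1 P.2.1 (P.2.2.1 i))| ≤ C) :
    |validationLoss f l r B b φ ξ P| ≤ C := by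
  have hnv' : (0 : ℝ) < nv := by exact_mod_cast hnv
  rw [validationLoss, abs_mul, abs_of_pos (by positivity), one_div, inv_mul_le_iff₀ hnv']
  refine (Finset.abs_sum_le_sum_abs _ _).trans ((Finset.sum_le_sum fun i _ => hC i).trans ?_)
  simp

/-! ### The generalization bound for LGD -/

theorem mainTheorem3 :
    ∃ K : ℝ, 0 < K ∧
      ∀ (Δ Λ : ℕ) (dx d h n nv B b : ℕ), 0 < nv → 0 < b →
      ∀ (f : Vec dx → Vec d → ℝ) (l : ℝ → ℝ → ℝ) (r : Vec d → Vec h → Vec d),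
      -- `f` is differentiable in the weights and `l` in the prediction
      (∀ x, Differentiable ℝ (f x)) → (∀ y, Differentiable ℝ (l y)) →
      -- GJ algorithms for `f`, `l` and the entries of `r`
      GJComputable (ι := Fin dx ⊕ Fin d) Δ Λ
        (fun v => f (WithLp.toLp 2 fun i => v (Sum.inl i)) (WithLp.toLp 2 fun j => v (Sum.inr j))) →
      GJComputable (ι := Fin 2) Δ Λ (fun v => l (v 0) (v 1)) →
      (∀ j : Fin d, GJComputable (ι := Fin d ⊕ Fin h) Δ Λ
        (fun v => r (WithLp.toLp 2 fun i => v (Sum.inl i))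
          (WithLp.toLp 2 fun i => v (Sum.inr i)) j)) →
      -- the distributions of the tasks and of the noise
      ∀ (D : Measure (RegTask dx n nv)) [IsProbabilityMeasure D]
        (DE : Measure (LangevinNoise (B + b) d)) [IsProbabilityMeasure DE] (C : ℝ),
      -- the loss of the LGD predictions is bounded by `C`
      (∀ P ∈ D.support, ∀ (φ : Hyperparam h) (ξ : LangevinNoise (B + b) d) (i : Fin nv),
        |l (P.2.2.2 i) (lgdPredict f l r B b φ ξ P.1 P.2.1 (P.2.2.1 i))| ≤ C) →
      -- `φstar` minimizes the expected validation loss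
      ∀ φstar : Hyperparam h,
      (∀ φ, expectedLoss f l r B b DE D φstar ≤ expectedLoss f l r B b DE D φ) →
      ∀ ε δ : ℝ, 0 < ε → 0 < δ → δ < 1 →
      ∀ T : ℕ,
      ENNReal.ofReal (K * C ^ 2 / ε ^ 2) *
        ((pdim (validationLossClass f l r B b D) : ENNReal) + ENNReal.ofReal (Real.log (1 / δ)))
        ≤ (T : ENNReal) →
      -- `φERM` minimizes the empirical validation loss on the sample
      ∀ φERM : (Fin T → LangevinNoise (B + b) d × RegTask dx n nv) → Hyperparam h,
      Measurable φERM →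
      (∀ᵐ ω ∂(Measure.pi fun _ : Fin T => DE.prod D),
        ∀ φ, empiricalLoss f l r B b ω (φERM ω) ≤ empiricalLoss f l r B b ω φ) →
      ENNReal.ofReal (1 - δ) ≤ (Measure.pi fun _ : Fin T => DE.prod D)
        {ω | expectedLoss f l r B b DE D (φERM ω) - expectedLoss f l r B b DE D φstar ≤ ε} := by
  refine ⟨100000, by norm_num, ?_⟩
  intro Δ Λ dx d h n nv B b hnv _ f l r hfd hld hfGJ hlGJ hrGJ D _ DE _ C hC φstar _ ε δ hε hδ hδ1
    T hT φERM hφERM hERM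
  have hf : Measurable (Function.uncurry f) := measurable_uncurry_of_euclidean hfGJ.measurable
  have hl : Measurable (Function.uncurry l) := by
    have hmap : Measurable fun q : ℝ × ℝ => (![q.1, q.2] : Fin 2 → ℝ) := by
      refine measurable_pi_lambda _ fun i => ?_
      fin_cases i
      · exact measurable_fst
      · exact measurable_snd
    exact hlGJ.measurable.comp hmap
  have hr : Measurable (Function.uncurry r) := by
    have h1 : Measurable fun q : Vec d × Vec h => fun j => r q.1 q.2 j :=
      measurable_pi_lambda _ fun j =>
        measurable_uncurry_of_euclidean (F := fun w θ => r w θ j) (hrGJ j).measurable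
    exact (WithLp.measurable_toLp 2 _).comp h1
  set μ := DE.prod D with hμ
  set g : Hyperparam h → LangevinNoise (B + b) d × RegTask dx n nv → ℝ :=
    fun φ z => validationLoss f l r B b φ z.1 z.2 with hg
  have hgm : Measurable (Function.uncurry g) := measurable_validationLoss hf hl hr hfd hld B b
  set A : Set (LangevinNoise (B + b) d × RegTask dx n nv) := {z | z.2 ∈ D.support} with hAdef
  have hA : ∀ᵐ z ∂μ, z ∈ A :=
    Measure.quasiMeasurePreserving_snd.ae (Measure.support_mem_ae (μ := D))
  have hgC : ∀ φ, ∀ z ∈ A, |g φ z| ≤ C := fun φ z hz =>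
    abs_validationLoss_le hnv fun i => hC z.2 hz φ z.1 i
  have hC0 : 0 ≤ C := by
    obtain ⟨z, hz⟩ := hA.exists
    exact (abs_nonneg _).trans (hgC φstar z hz)
  have htriv : (∀ φ φ', ∀ z ∈ A, g φ z = g φ' z) → ENNReal.ofReal (1 - δ) ≤
      (Measure.pi fun _ : Fin T => μ)
        {ω | expectedLoss f l r B b DE D (φERM ω) - expectedLoss f l r B b DE D φstar ≤ ε} := by
    intro heq
    have huniv : {ω | expectedLoss f l r B b DE D (φERM ω) - expectedLoss f l r B b DE D φstar
        ≤ ε} = Set.univ := by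
      refine Set.eq_univ_of_forall fun ω => ?_
      have : expectedLoss f l r B b DE D (φERM ω) = expectedLoss f l r B b DE D φstar :=
        integral_congr_ae (hA.mono fun z hz => heq _ _ z hz)
      simp [this, hε.le]
    rw [huniv, measure_univ]
    exact ENNReal.ofReal_le_one.2 (by linarith)
  -- The case C = 0 has to be split off before infinite pseudo-dimension is ruled out: 0 · ⊤ = 0
  -- would leave the sample-size condition without content.
  rcases hC0.eq_or_lt with hC0 | hCpos
  · refine htriv fun φ φ' z hz => ?_
    have h1 := hgC φ z hz
    have h2 := hgC φ' z hz
    rw [← hC0] at h1 h2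
    rw [abs_nonpos_iff.1 h1, abs_nonpos_iff.1 h2]
  by_cases hp0 : pdim (validationLossClass f l r B b D) = 0
  · refine htriv fun φ φ' z hz => ?_
    exact le_antisymm
      (le_of_pdim_eq_zero hp0 (Set.mem_range_self φ) (Set.mem_range_self φ') (z.1, ⟨z.2, hz⟩))
      (le_of_pdim_eq_zero hp0 (Set.mem_range_self φ') (Set.mem_range_self φ) (z.1, ⟨z.2, hz⟩))
  have hK : 0 < 100000 * C ^ 2 / ε ^ 2 := by positivity
  have hpt : pdim (validationLossClass f l r B b D) ≠ ⊤ := by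
    intro htop
    rw [htop, ENat.toENNReal_top, top_add, ENNReal.mul_top (by simpa using hK)] at hT
    exact absurd hT (by simp)
  obtain ⟨m, hm⟩ := ENat.ne_top_iff_exists.1 hpt
  have hm1 : 1 ≤ m := by
    rcases Nat.eq_zero_or_pos m with h0 | h0
    · exact absurd (by rw [← hm, h0]; rfl) hp0
    · exact h0
  have hlog : 0 ≤ Real.log (1 / δ) := Real.log_nonneg (by rw [le_div_iff₀ hδ]; linarith)
  have hTreal : 100000 * C ^ 2 * (m + Real.log (1 / δ)) ≤ T * ε ^ 2 := by
    rw [← hm, ENat.toENNReal_coe, ← ENNReal.ofReal_natCast m,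
      ← ENNReal.ofReal_add (by positivity) hlog, ← ENNReal.ofReal_mul hK.le,
      ← ENNReal.ofReal_natCast T, ENNReal.ofReal_le_ofReal_iff (by positivity),
      div_mul_eq_mul_div, div_le_iff₀ (by positivity)] at hT
    exact hT
  have hTpos : (0 : ℝ) < T := by
    have h1 : 0 < 100000 * C ^ 2 * (m + Real.log (1 / δ)) := by
      have : (1 : ℝ) ≤ m := by exact_mod_cast hm1
      positivity
    by_contra! h2
    have h3 : (T : ℝ) * ε ^ 2 ≤ 0 := mul_nonpos_of_nonpos_of_nonneg h2 (by positivity)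
    linarith
  have hERM' : ∀ᵐ ω ∂(Measure.pi fun _ : Fin T => μ),
      ∑ t, g (φERM ω) (ω t) ≤ ∑ t, g φstar (ω t) := by
    filter_upwards [hERM] with ω hω
    exact le_of_mul_le_mul_left (hω φstar) (by positivity)
  have hmain := measure_excess_risk_gt_le μ hgm hA hCpos hgC hm1
    (fun z hz => subgraphDimLE_of_pdim_le hm.ge _ (fun t => ((z t).1, ⟨(z t).2, hz t⟩))
      fun φ => ⟨_, Set.mem_range_self φ, fun _ => rfl⟩)
    hε hδ hδ1 hTreal φstar hφERM hERM'
  -- Subadditivity replaces the measure of a complement, so the good event need not be shown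
  -- measurable.
  have hcover : (1 : ENNReal) ≤ (Measure.pi fun _ : Fin T => μ)
        {ω | expectedLoss f l r B b DE D (φERM ω) - expectedLoss f l r B b DE D φstar ≤ ε} +
      ENNReal.ofReal δ := by
    calc (1 : ENNReal) = (Measure.pi fun _ : Fin T => μ) Set.univ := measure_univ.symm
      _ ≤ _ := measure_mono fun ω _ => le_or_gt
        (expectedLoss f l r B b DE D (φERM ω) - expectedLoss f l r B b DE D φstar) ε
      _ ≤ _ := measure_union_le {ω | expectedLoss f l r B b DE D (φERM ω) -
        expectedLoss f l r B b DE D φstar ≤ ε} {ω | ε < expectedLoss f l r B b DE D (φERM ω) -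
        expectedLoss f l r B b DE D φstar}
      _ ≤ _ := by gcongr; exact hmain
  rw [ENNReal.ofReal_sub _ hδ.le, ENNReal.ofReal_one]
  exact tsub_le_iff_right.2 hcover
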